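/- Let $\nu>0$, let $\mathcal S\subset\mathbb R^k$ be compact and let $W=\{W(x)\}_{x\in\mathcal S}$ be a real-valued process with continuous sample paths, $\mathbb E\{\sup_{x}W(x)\}<\infty$ and $m_+(x)=\mathbb E[\max\{W(x),0\}^\nu]\in(0,\infty)$ for all $x\in\mathcal S$. Powers of real numbers are understood as $x^p=\operatorname{sign}(x)|x|^p$ in the expressions $W^\nu$, $\mathbf u^\circ$, $\mathbf v^\circ$ below, and all operations on vectors are coordinatewise. For sites $\mathbf x=(x_1,\dots,x_n)\in\mathcal S^n$ let $$\Lambda_{\mathbf x}(A)=\int_0^\infty \Pr\{\zeta W(\mathbf x)^\nu/m_+(\mathbf x)\in A\}\,\zeta^{-2}\,d\zeta ,\qquad A\subset\mathbb R^n\text{ Borel},$$ and call a non-negative Borel function $\lambda_{\mathbf x}$ an intensity function at $\mathbf x$ if $\Lambda_{\mathbf x}(A)=\int_A\lambda_{\mathbf x}(\mathbf z)\,d\mathbf z$ for all Borel $A$. Let $m\ge 0$, $d\ge1$, $\mathbf t\in\mathcal S^m$, $\mathbf s\in\mathcal S^d$. Suppose that $(W(\mathbf t),W(\mathbf s))$ is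 extended skew-normal with correlation matrix $\bar\Omega=\begin{pmatrix}\bar\Omega_{\mathbf t}&\bar\Omega_{\mathbf t\mathbf s}\\ \bar\Omega_{\mathbf s\mathbf t}&\bar\Omega_{\mathbf s}\end{pmatrix}$, slant $\alpha=(\alpha_{\mathbf t},\alpha_{\mathbf s})\in\mathbb R^{m+d}$ and extension $\tau\in\mathbb R$, where $\bar\Omega$ is positive definite with unit diagonal; that is, it has density $\phi_{m+d}(y;\bar\Omega)\,\Phi(\alpha^\top y+\tau)/\Phi(\tau/\sqrt{1+\alpha^\top\bar\Omega\alpha})$, with $\phi_{m+d}(\cdot;\bar\Omega)$ the centred Gaussian density with covariance $\bar\Omega$ and $\Phi$ the standard normal cdf. For $\mathbf u\in\mathbb R^m$ and $\mathbf v\in(0,\infty)^d$ put $\mathbf u^\circ=(\mathbf u\,m_+(\mathbf t))^{1/\nu}$, $\mathbf v^\circ=(\mathbf v\,m_+(\mathbf s))^{1/\nu}$, $Q=\mathbf v^{\circ\top}\bar\Omega_{\mathbf s}^{-1}\mathbf v^\circ$, $\tilde\Omega=\bar\Omega_{\mathbf t}-\bar\Omega_{\mathbf t\mathbf s}\bar\Omega_{\mathbf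 s}^{-1}\bar\Omega_{\mathbf s\mathbf t}$, $\tilde\omega=\operatorname{diag}(\tilde\Omega)^{1/2}$ and $$\mu_c=\bar\Omega_{\mathbf t\mathbf s}\bar\Omega_{\mathbf s}^{-1}\mathbf v^\circ,\quad \Omega_c=\frac{Q}{\nu+d}\,\tilde\Omega,\quad \alpha_c=\tilde\omega\,\alpha_{\mathbf t},\quad \tau_c=(\alpha_{\mathbf s}+\bar\Omega_{\mathbf s}^{-1}\bar\Omega_{\mathbf s\mathbf t}\alpha_{\mathbf t})^\top\mathbf v^\circ\,(\nu+d)^{1/2}Q^{-1/2},\quad \kappa_c=-\tau,\quad \nu_c=\nu+d .$$ Then the conditional intensity function $\lambda_{\mathbf t|\mathbf s,\mathbf v}(\mathbf u)=\lambda_{(\mathbf t,\mathbf s)}(\mathbf u,\mathbf v)/\lambda_{\mathbf s}(\mathbf v)$ is given by $$\lambda_{\mathbf t|\mathbf s,\mathbf v}(\mathbf u)=\psi_m(\mathbf u^\circ;\mu_c,\Omega_c,\alpha_c,\tau_c,\kappa_c,\nu_c)\;\nu^{-m}\prod_{i=1}^m\bigl(m_+(t_i)|u_i|^{1-\nu}\bigr)^{1/\nu}.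 \qquad(*)$$ Here $\psi_m$ is the non-central extended skew-$t$ density $$\psi_m(y;\mu,\Omega,\alpha,\tau,\kappa,\nu)=\frac{\psi_m(y;\mu,\Omega,\nu)}{\Psi\bigl(\tfrac{\tau}{\sqrt{1+\alpha^\top\bar\Omega'\alpha}};\tfrac{\kappa}{\sqrt{1+\alpha^\top\bar\Omega'\alpha}},\nu\bigr)}\,\Psi\Bigl\{(\alpha^\top z+\tau)\sqrt{\tfrac{\nu+m}{\nu+z^\top\bar\Omega'^{-1}z}};\kappa,\nu+m\Bigr\},$$ with $\omega=\operatorname{diag}(\Omega)^{1/2}$, $z=\omega^{-1}(y-\mu)$, $\bar\Omega'=\omega^{-1}\Omega\omega^{-1}$, $\psi_m(y;\mu,\Omega,\nu)$ the $m$-dimensional Student-$t$ density with location $\mu$, scale matrix $\Omega$ and $\nu$ degrees of freedom, and $\Psi(\cdot;\kappa,\nu)$ the univariate non-central $t$ cdf. Precisely: (i) there are intensity functions $\lambda_{(\mathbf t,\mathbf s)}$ and $\lambda_{\mathbf s}$ that are continuous away from the origin (and, if $\nu>1$, away from the coordinate hyperplanes) and for which $\lambda_{\mathbf s}(\mathbf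 v)>0$ and $(*)$ hold for all $\mathbf v\in(0,\infty)^d$ and all $\mathbf u\in\mathbb R^m$ (with non-zero coordinates if $\nu>1$); (ii) for any intensity functions $\lambda_{(\mathbf t,\mathbf s)}$ and $\lambda_{\mathbf s}$, $\lambda_{\mathbf s}(\mathbf v)>0$ and $(*)$ hold for Lebesgue-almost every $(\mathbf u,\mathbf v)\in\mathbb R^m\times(0,\infty)^d$. -/

import Mathlib

open MeasureTheory ProbabilityTheory Matrix

namespace ExtremalSkewT

/-- The standard normal cdf `Φ`. -/
noncomputable def normalCdf (x : ℝ) : ℝ :=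
  (gaussianReal 0 1).real (Set.Iic x)

/-- The univariate non-central `t` distribution with non-centrality `κ` and `ν` degrees of freedom:
the law of `(Z + κ) / √(V / ν)`, with `Z` standard normal and `V` an independent `χ²_ν` variable
(the Gamma law with shape `ν / 2` and rate `1 / 2`). -/
noncomputable def noncentralT (κ ν : ℝ) : Measure ℝ :=
  ((gaussianReal 0 1).prod (gammaMeasure (ν / 2) (1 / 2))).map
    (fun p : ℝ × ℝ => (p.1 + κ) / √(p.2 / ν))

/-- The cdf `Ψ(x; κ, ν)` of the univariate non-central `t` distribution. -/
noncomputable def noncentralTCdf (x κ ν : ℝ) : ℝ :=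
  (noncentralT κ ν).real (Set.Iic x)

section Densities

variable {ι : Type*} [Fintype ι] [DecidableEq ι]

/-- The quadratic form `x ↦ xᵀ A x`. -/
def quadForm (A : Matrix ι ι ℝ) (x : ι → ℝ) : ℝ :=
  x ⬝ᵥ (A *ᵥ x)

/-- The centred Gaussian density with covariance matrix `R`. -/
noncomputable def gaussianDensity (R : Matrix ι ι ℝ) (y : ι → ℝ) : ℝ :=
  (2 * Real.pi) ^ (-(Fintype.card ι : ℝ) / 2) * R.det ^ (-(1 / 2) : ℝ)
    * Real.exp (-(quadForm R⁻¹ y) / 2)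

/-- The density of the extended skew-normal law with correlation matrix `R`, slant `α` and
extension `τ`. -/
noncomputable def extSkewNormalDensity (R : Matrix ι ι ℝ) (α : ι → ℝ) (τ : ℝ) (y : ι → ℝ) : ℝ :=
  gaussianDensity R y * normalCdf (α ⬝ᵥ y + τ) / normalCdf (τ / √(1 + quadForm R α))

/-- The extended skew-normal law on `ℝ^ι`. -/
noncomputable def extSkewNormal (R : Matrix ι ι ℝ) (α : ι → ℝ) (τ : ℝ) : Measure (ι → ℝ) :=
  volume.withDensity (fun y => ENNReal.ofReal (extSkewNormalDensity R α τ y))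

/-- The density of the multivariate `t` distribution with location `μ`, scale matrix `S` and `ν`
degrees of freedom. -/
noncomputable def tDensity (y μ : ι → ℝ) (S : Matrix ι ι ℝ) (ν : ℝ) : ℝ :=
  Real.Gamma ((ν + Fintype.card ι) / 2)
    / (Real.Gamma (ν / 2) * (ν * Real.pi) ^ ((Fintype.card ι : ℝ) / 2) * √S.det)
    * (1 + quadForm S⁻¹ (y - μ) / ν) ^ (-(ν + Fintype.card ι) / 2)

/-- The standard deviations `ω = diag(S)^{1/2}`. -/
noncomputable def stdDev (S : Matrix ι ι ℝ) (i : ι) : ℝ := √(S i i)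

/-- The correlation matrix `ω⁻¹ S ω⁻¹` of the scale matrix `S`. -/
noncomputable def corrMatrix (S : Matrix ι ι ℝ) : Matrix ι ι ℝ :=
  Matrix.of fun i j => S i j / (stdDev S i * stdDev S j)

/-- The density of the non-central extended skew-`t` distribution with location `μ`, scale matrix
`S`, slant `α`, extension `τ`, non-centrality `κ` and `ν` degrees of freedom. -/
noncomputable def skewTDensity (y μ : ι → ℝ) (S : Matrix ι ι ℝ) (α : ι → ℝ) (τ κ ν : ℝ) : ℝ :=
  let z : ι → ℝ := fun i => (y i - μ i) / stdDev S i
  let c : ℝ := √(1 + quadForm (corrMatrix S) α)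
  tDensity y μ S ν / noncentralTCdf (τ / c) (κ / c) ν
    * noncentralTCdf
        ((α ⬝ᵥ z + τ) * √((ν + Fintype.card ι) / (ν + quadForm (corrMatrix S)⁻¹ z)))
        κ (ν + Fintype.card ι)

end Densities

/-- The real power extended to the whole line as an odd function, `sign(x) |x|^p`. -/
noncomputable def signedPow (x p : ℝ) : ℝ := Real.sign x * |x| ^ p

section Model

variable {Ω : Type*} [MeasurableSpace Ω]

/-- The normalizing function `m₊(x) = E[W(x)₊^ν]`. -/
noncomputable def mPlus {X : Type*} (P : Measure Ω) (ν : ℝ) (W : X → Ω → ℝ) (x : X) : ℝ :=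
  ∫ ω, (max (W x ω) 0) ^ ν ∂P

/-- The standing conditions on the process `W` in the spectral representation of a max-stable
process on the region `S`. -/
structure IsSpectralProcess {k : ℕ} (S : Set (EuclideanSpace ℝ (Fin k))) (P : Measure Ω) (ν : ℝ)
    (W : S → Ω → ℝ) : Prop where
  isCompact : IsCompact S
  measurable : ∀ x, Measurable (W x)
  continuous_paths : ∀ ω, Continuous (fun x => W x ω)
  expectation_sup_lt_top : ∫⁻ ω, ENNReal.ofReal (⨆ x, W x ω) ∂P < ⊤
  integrable_moment : ∀ x, Integrable (fun ω => (max (W x ω) 0) ^ ν) P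
  mPlus_pos : ∀ x, 0 < mPlus P ν W x

variable {ι : Type*} [Fintype ι]

/-- The intensity measure at the sites `x`,
`Λ_x(A) = ∫₀^∞ P(ζ W(x)^ν / m₊(x) ∈ A) ζ⁻² dζ`. -/
noncomputable def intensityMeasure {X : Type*} (P : Measure Ω) (ν : ℝ) (W : X → Ω → ℝ)
    (x : ι → X) (A : Set (ι → ℝ)) : ENNReal :=
  ∫⁻ ζ in Set.Ioi (0 : ℝ),
    P {ω | (fun i => ζ * signedPow (W (x i) ω) ν / mPlus P ν W (x i)) ∈ A}
      * ENNReal.ofReal ((ζ ^ 2)⁻¹)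

/-- `lam` is an intensity function at the sites `x`: a (non-negative, Borel) Lebesgue density of
the intensity measure, `Λ_x(A) = ∫_A lam(v) dv` for all Borel sets `A`. -/
def IsIntensityFunction {X : Type*} (P : Measure Ω) (ν : ℝ) (W : X → Ω → ℝ)
    (x : ι → X) (lam : (ι → ℝ) → ℝ) : Prop :=
  Measurable lam ∧ (∀ v, 0 ≤ lam v) ∧
    ∀ A : Set (ι → ℝ), MeasurableSet A →
      intensityMeasure P ν W x A = ∫⁻ v in A, ENNReal.ofReal (lam v)

/-- The transformation `v° = (v m₊)^{1/ν}`, coordinate by coordinate. -/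
noncomputable def circ (ν : ℝ) (mp : ι → ℝ) (v : ι → ℝ) : ι → ℝ :=
  fun i => signedPow (v i * mp i) (1 / ν)

/-- The points at which intensity functions are regular: the origin is excluded, and so are the
coordinate hyperplanes if `ν > 1` (there `|v_i|^{1 - ν}` is infinite). -/
def regularSet (ι : Type*) (ν : ℝ) : Set (ι → ℝ) :=
  {v | v ≠ 0 ∧ (1 < ν → ∀ i, v i ≠ 0)}

end Model

/-- The conditional intensity function `λ_{t|s,v}(u) = λ_{(t,s)}(u, v) / λ_s(v)`. -/
noncomputable def condIntensity {m d : ℕ} (lamTS : (Fin m ⊕ Fin d → ℝ) → ℝ)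
    (lamS : (Fin d → ℝ) → ℝ) (v : Fin d → ℝ) (u : Fin m → ℝ) : ℝ :=
  lamTS (Sum.elim u v) / lamS v

section Parameters

variable {m d : ℕ}

/-- The Schur complement `Ω̃ = Ω_t - Ω_ts Ω_s⁻¹ Ω_st`. -/
noncomputable def schur (R : Matrix (Fin m ⊕ Fin d) (Fin m ⊕ Fin d) ℝ) :
    Matrix (Fin m) (Fin m) ℝ :=
  R.toBlocks₁₁ - R.toBlocks₁₂ * (R.toBlocks₂₂)⁻¹ * R.toBlocks₂₁

/-- The location `Ω_ts Ω_s⁻¹ v°`; the argument `w` is `v°`, here and below. -/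
noncomputable def condLocation (R : Matrix (Fin m ⊕ Fin d) (Fin m ⊕ Fin d) ℝ) (w : Fin d → ℝ) :
    Fin m → ℝ :=
  (R.toBlocks₁₂ * (R.toBlocks₂₂)⁻¹) *ᵥ w

/-- The scale matrix `(v°ᵀ Ω_s⁻¹ v° / (ν + d)) Ω̃`. -/
noncomputable def condScale (R : Matrix (Fin m ⊕ Fin d) (Fin m ⊕ Fin d) ℝ) (ν : ℝ)
    (w : Fin d → ℝ) : Matrix (Fin m) (Fin m) ℝ :=
  (quadForm (R.toBlocks₂₂)⁻¹ w / (ν + d)) • schur R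

/-- The slant `ω̃ α_t`, with `ω̃ = diag(Ω̃)^{1/2}`. -/
noncomputable def condSlant (R : Matrix (Fin m ⊕ Fin d) (Fin m ⊕ Fin d) ℝ)
    (α : Fin m ⊕ Fin d → ℝ) : Fin m → ℝ :=
  fun i => stdDev (schur R) i * α (Sum.inl i)

/-- The extension `(α_s + Ω_s⁻¹ Ω_st α_t)ᵀ v° (ν + d)^{1/2} (v°ᵀ Ω_s⁻¹ v°)^{-1/2}`. -/
noncomputable def condExtension (R : Matrix (Fin m ⊕ Fin d) (Fin m ⊕ Fin d) ℝ)
    (α : Fin m ⊕ Fin d → ℝ) (ν : ℝ) (w : Fin d → ℝ) : ℝ :=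
  ((α ∘ Sum.inr + ((R.toBlocks₂₂)⁻¹ * R.toBlocks₂₁) *ᵥ (α ∘ Sum.inl)) ⬝ᵥ w)
    * √(ν + d) / √(quadForm (R.toBlocks₂₂)⁻¹ w)

/-- The claimed conditional intensity at `u` given `v`: the non-central extended skew-`t` density at
`u°` times the Jacobian factor `ν^{-m} ∏ (m₊(t_i) |u_i|^{1-ν})^{1/ν}`. The arguments `mt`, `ms`
are the values of `m₊` at the sites `t` and `s`. -/
noncomputable def skewTCondIntensity (R : Matrix (Fin m ⊕ Fin d) (Fin m ⊕ Fin d) ℝ)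
    (α : Fin m ⊕ Fin d → ℝ) (τ ν : ℝ) (mt : Fin m → ℝ) (ms : Fin d → ℝ)
    (v : Fin d → ℝ) (u : Fin m → ℝ) : ℝ :=
  skewTDensity (circ ν mt u) (condLocation R (circ ν ms v)) (condScale R ν (circ ν ms v))
      (condSlant R α) (condExtension R α ν (circ ν ms v)) (-τ) (ν + d)
    * ((ν ^ m)⁻¹ * ∏ i, (mt i * |u i| ^ (1 - ν)) ^ (1 / ν))

end Parameters

end ExtremalSkewT

/-! Suppose `W` at n sites has density `F`. In the mixing integral for Λ substitute ζ = r^{-ν} and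
rescale y ↦ r y. Since y ↦ y^ν / m₊ is homogeneous of degree ν, the event no longer depends on r,
and the intensity at v is the Jacobian of v ↦ v° times ν ∫₀^∞ r^{ν+n-1} F(r v°) dr
(`intensityMeasure_eq_lintegral`).

For F = K φ(·; R) Φ(β·y + τ), the ray integral is ∫ r^{p-1} exp(-r² q / 2) Φ(r a + τ) dr with p = ν
+ n, q = v°ᵀR⁻¹v° and a = β·v°. The substitution r² q = v turns its Gaussian factor into a χ²_p
density, so the integral is an explicit constant times q^{-p/2} times a non-central t cdf with
non-centrality -τ (`radialIntegral_eq`).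

The extended skew-normal family is closed under marginals (`map_comp_inr_extSkewNormal`), so both
intensities have this shape with the same K. In their quotient K and the Jacobian at v cancel. The
Schur decomposition q = Q + (u° - μ_c)ᵀΩ̃⁻¹(u° - μ_c) makes the powers of q and Q a Student-t
density, and the two cdfs give the skewing factor and its normalization
(`skewTDensity_condParameters`).

Dominated convergence gives continuity of these versions, and uniqueness of densities carries the
formula to any other versions almost everywhere. -/

namespace ExtremalSkewT

open scoped ENNReal NNReal

/-! ### Densities of product measures. -/

section ProductDensity

variable {E : Type*} [MeasurableSpace E]

/-- Tonelli's theorem for a product of functions of one coordinate each. -/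
theorem lintegral_fin_prod_eq_prod {n : ℕ} {μ : Fin n → Measure E} [∀ i, SigmaFinite (μ i)]
    {f : Fin n → E → ℝ≥0∞} (hf : ∀ i, Measurable (f i)) :
    ∫⁻ x, ∏ i, f i (x i) ∂(Measure.pi μ) = ∏ i, ∫⁻ x, f i x ∂(μ i) := by
  induction n with
  | zero => simp
  | succ n n_ih =>
    have hm : Measurable fun x : Fin n → E => ∏ i : Fin n, f i.succ (x i) :=
      Finset.measurable_prod _ fun i _ => (hf i.succ).comp (measurable_pi_apply i)
    have h := (measurePreserving_piFinSuccAbove μ 0).symm.lintegral_comp_emb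
      (MeasurableEquiv.measurableEmbedding _) (fun x => ∏ i, f i (x i))
    rw [← h, Fin.prod_univ_succ, ← n_ih fun i => hf i.succ,
      ← lintegral_prod_mul (hf 0).aemeasurable hm.aemeasurable]
    refine lintegral_congr fun x => ?_
    rw [Fin.prod_univ_succ]
    rfl

theorem lintegral_fintype_prod_eq_prod {ι : Type*} [Fintype ι] {μ : ι → Measure E}
    [∀ i, SigmaFinite (μ i)] {f : ι → E → ℝ≥0∞} (hf : ∀ i, Measurable (f i)) :
    ∫⁻ x, ∏ i, f i (x i) ∂(Measure.pi μ) = ∏ i, ∫⁻ x, f i x ∂(μ i) := by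
  let e := (Fintype.equivFin ι).symm
  rw [← (measurePreserving_piCongrLeft _ e).lintegral_comp_emb
    (MeasurableEquiv.measurableEmbedding _)]
  simp_rw [← e.prod_comp, MeasurableEquiv.coe_piCongrLeft, Equiv.piCongrLeft_apply_apply]
  exact lintegral_fin_prod_eq_prod fun i => hf _

/-- Used both for the standard Gaussian law and for the Jacobian of a coordinatewise map. Finiteness
of the densities keeps the factors σ-finite, so that values on boxes determine the product measure.
-/
theorem pi_withDensity {ι : Type*} [Fintype ι] (μ : ι → Measure E) [∀ i, SigmaFinite (μ i)]
    {f : ι → E → ℝ≥0∞} (hf : ∀ i, Measurable (f i)) (hfin : ∀ i x, f i x ≠ ⊤) :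
    Measure.pi (fun i => (μ i).withDensity (f i)) =
      (Measure.pi μ).withDensity (fun x => ∏ i, f i (x i)) := by
  have : ∀ i, SigmaFinite ((μ i).withDensity (f i)) := fun i =>
    SigmaFinite.withDensity_of_ne_top (ae_of_all _ (hfin i))
  refine Measure.pi_eq fun s hs => ?_
  rw [withDensity_apply _ (MeasurableSet.univ_pi hs), Measure.restrict_pi_pi,
    lintegral_fintype_prod_eq_prod hf]
  simp_rw [withDensity_apply _ (hs _)]

end ProductDensity

/-! ### The normal cdf and its Gaussian averages. -/

section NormalCdf

theorem normalCdf_nonneg (x : ℝ) : 0 ≤ normalCdf x := measureReal_nonneg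

theorem normalCdf_le_one (x : ℝ) : normalCdf x ≤ 1 := measureReal_le_one

theorem normalCdf_mono : Monotone normalCdf := fun _ _ h =>
  measureReal_mono (Set.Iic_subset_Iic.2 h)

@[fun_prop]
theorem measurable_normalCdf : Measurable normalCdf := normalCdf_mono.measurable

theorem normalCdf_eq_integral (x : ℝ) :
    normalCdf x = ∫ y in Set.Iic x, gaussianPDFReal 0 1 y := by
  rw [normalCdf, measureReal_def, gaussianReal_apply_eq_integral _ one_ne_zero,
    ENNReal.toReal_ofReal (integral_nonneg fun y => gaussianPDFReal_nonneg _ _ _)]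

theorem normalCdf_pos (x : ℝ) : 0 < normalCdf x := by
  rw [normalCdf_eq_integral, setIntegral_pos_iff_support_of_nonneg_ae
    (ae_of_all _ fun y => gaussianPDFReal_nonneg _ _ _)
    (integrable_gaussianPDFReal 0 1).integrableOn]
  have : Function.support (gaussianPDFReal 0 1) = Set.univ :=
    Function.support_eq_univ fun y => (gaussianPDFReal_pos 0 1 y one_ne_zero).ne'
  simp [this]

@[fun_prop]
theorem continuous_normalCdf : Continuous normalCdf := by
  have h : normalCdf = fun x => normalCdf 0 + ∫ y in (0 : ℝ)..x, gaussianPDFReal 0 1 y := by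
    ext x
    rw [normalCdf_eq_integral, normalCdf_eq_integral, ← intervalIntegral.integral_Iic_sub_Iic
      (integrable_gaussianPDFReal 0 1).integrableOn (integrable_gaussianPDFReal 0 1).integrableOn]
    ring
  rw [h]
  exact continuous_const.add (intervalIntegral.continuous_primitive
    (fun a b => (integrable_gaussianPDFReal 0 1).intervalIntegrable) 0)

theorem ofReal_normalCdf (x : ℝ) :
    ENNReal.ofReal (normalCdf x) = gaussianReal 0 1 (Set.Iic x) := ofReal_measureReal

/-- With Z standard normal independent of Y ~ N(0, v), the left side is Pr(Z - Y ≤ a), and Z - Y ~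
N(0, 1 + v). -/
theorem lintegral_normalCdf_add_gaussianReal (a : ℝ) (v : ℝ≥0) :
    ∫⁻ y, ENNReal.ofReal (normalCdf (a + y)) ∂(gaussianReal 0 v) =
      ENNReal.ofReal (normalCdf (a / √(1 + v))) := by
  have h1 : (gaussianReal 0 v ∗ gaussianReal 0 1) (Set.Iic a) =
      ENNReal.ofReal (normalCdf (a / √(1 + v))) := by
    rw [gaussianReal_conv_gaussianReal, ofReal_normalCdf]
    have hpos : 0 < √(1 + v) := by positivity
    have : gaussianReal 0 (v + 1) = (gaussianReal 0 1).map (√(1 + v) * ·) := by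
      rw [gaussianReal_map_const_mul]
      congr 1
      · simp
      · ext
        simp [Real.sq_sqrt (by positivity : (0 : ℝ) ≤ v + 1), add_comm (1 : ℝ)]
    rw [add_zero, this, Measure.map_apply (by fun_prop) measurableSet_Iic]
    congr 1
    ext x
    simp [le_div_iff₀ hpos, mul_comm]
  rw [← h1, Measure.conv, Measure.map_apply (by fun_prop) measurableSet_Iic,
    Measure.prod_apply (measurableSet_Iic.preimage (by fun_prop))]
  -- The convolution gives the law of Y + Z; symmetry of Y replaces this by Z - Y.
  have h2 : gaussianReal 0 v = (gaussianReal 0 v).map (fun x => -x) := by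
    rw [gaussianReal_map_neg, neg_zero]
  conv_lhs => rw [h2]
  rw [lintegral_map (by fun_prop) (by fun_prop)]
  refine lintegral_congr fun y => ?_
  rw [ofReal_normalCdf]
  congr 1
  ext x
  simp only [Set.mem_Iic, Set.mem_preimage]
  constructor <;> intro h <;> linarith

variable {ι : Type*} [Fintype ι]

/-- The variance of a linear functional under the standard Gaussian law is its squared Euclidean
norm. -/
theorem pi_gaussianReal_map_dotProduct (β : ι → ℝ) :
    (Measure.pi fun _ : ι => gaussianReal 0 1).map (fun z => β ⬝ᵥ z) =
      gaussianReal 0 (β ⬝ᵥ β).toNNReal := by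
  have h : (fun z : ι → ℝ => β ⬝ᵥ z) =
      (innerSL ℝ (WithLp.toLp 2 β : EuclideanSpace ℝ ι)) ∘ (WithLp.toLp 2) := by
    ext z
    simp [PiLp.inner_apply, dotProduct, mul_comm]
  rw [h, ← Measure.map_map (by fun_prop) (by fun_prop), map_pi_eq_stdGaussian,
    IsGaussian.map_eq_gaussianReal, integral_strongDual_stdGaussian, variance_dual_stdGaussian]
  congr 2
  rw [innerSL_apply_norm, EuclideanSpace.real_norm_sq_eq]
  simp [dotProduct, sq]

theorem lintegral_normalCdf_pi_gaussianReal (a : ℝ) (β : ι → ℝ) :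
    ∫⁻ z, ENNReal.ofReal (normalCdf (a + β ⬝ᵥ z)) ∂(Measure.pi fun _ : ι => gaussianReal 0 1) =
      ENNReal.ofReal (normalCdf (a / √(1 + β ⬝ᵥ β))) := by
  have h0 : 0 ≤ β ⬝ᵥ β := Finset.sum_nonneg fun i _ => mul_self_nonneg _
  have := lintegral_normalCdf_add_gaussianReal a (β ⬝ᵥ β).toNNReal
  rw [← pi_gaussianReal_map_dotProduct, lintegral_map (by fun_prop)
    (by unfold dotProduct; fun_prop),
    Real.coe_toNNReal _ h0] at this
  exact this

theorem quadForm_mul_transpose (L : Matrix ι ι ℝ) (x : ι → ℝ) :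
    quadForm (L * Lᵀ) x = (Lᵀ *ᵥ x) ⬝ᵥ (Lᵀ *ᵥ x) := by
  rw [quadForm, ← mulVec_mulVec, dotProduct_mulVec, ← mulVec_transpose]

variable [DecidableEq ι]

theorem pi_gaussianReal_eq_withDensity :
    (Measure.pi fun _ : ι => gaussianReal 0 1) =
      volume.withDensity fun z => ENNReal.ofReal (gaussianDensity (1 : Matrix ι ι ℝ) z) := by
  have h : (fun _ : ι => gaussianReal 0 1) =
      fun _ : ι => volume.withDensity (gaussianPDF 0 1) := by
    rw [gaussianReal_of_var_ne_zero _ one_ne_zero]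
  rw [h, pi_withDensity _ (fun _ => measurable_gaussianPDF 0 1) (fun _ _ => gaussianPDF_ne_top),
    ← volume_pi]
  congr 1
  ext z
  simp_rw [gaussianPDF]
  rw [← ENNReal.ofReal_prod_of_nonneg fun i _ => gaussianPDFReal_nonneg _ _ _]
  congr 1
  simp_rw [gaussianPDFReal, gaussianDensity, Finset.prod_mul_distrib, ← Real.exp_sum]
  simp only [NNReal.coe_one, mul_one, sub_zero, Finset.prod_const, Finset.card_univ, det_one,
    Real.one_rpow, inv_one, quadForm, one_mulVec]
  congr 1
  · rw [Real.sqrt_eq_rpow, ← Real.rpow_neg (by positivity), ← Real.rpow_natCast,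
      ← Real.rpow_mul (by positivity)]
    congr 1; ring
  · congr 1
    simp only [dotProduct, ← Finset.sum_div, Finset.sum_neg_distrib, sq]

theorem exists_mul_transpose_eq {S : Matrix ι ι ℝ} (hS : S.PosDef) :
    ∃ L : Matrix ι ι ℝ, L.det ≠ 0 ∧ S = L * Lᵀ := by
  open scoped MatrixOrder Matrix.Norms.L2Operator in
  obtain ⟨B, hB, rfl⟩ := CStarAlgebra.isStrictlyPositive_iff_eq_mul_star_self.mp
    (isStrictlyPositive_iff_posDef.2 hS)
  exact ⟨B, ((isUnit_iff_isUnit_det B).1 hB).ne_zero, by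
    rw [star_eq_conjTranspose, conjTranspose_eq_transpose_of_trivial]⟩

theorem gaussianDensity_mul_transpose_mulVec {L : Matrix ι ι ℝ} (hL : L.det ≠ 0) (z : ι → ℝ) :
    gaussianDensity (L * Lᵀ) (L *ᵥ z) =
      |L.det|⁻¹ * gaussianDensity (1 : Matrix ι ι ℝ) z := by
  have hq : quadForm (L * Lᵀ)⁻¹ (L *ᵥ z) = quadForm (1 : Matrix ι ι ℝ)⁻¹ z := by
    have hu : IsUnit L.det := hL.isUnit
    rw [Matrix.mul_inv_rev, quadForm, mulVec_mulVec, Matrix.mul_assoc, nonsing_inv_mul _ hu,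
      Matrix.mul_one, dotProduct_mulVec, ← mulVec_transpose, transpose_nonsing_inv,
      transpose_transpose, mulVec_mulVec, nonsing_inv_mul _ hu, quadForm, inv_one,
      dotProduct_comm]
  have hd : (L * Lᵀ).det ^ (-(1 / 2) : ℝ) = |L.det|⁻¹ := by
    rw [det_mul, det_transpose, ← abs_mul_abs_self, Real.rpow_neg (by positivity),
      ← Real.sqrt_eq_rpow, Real.sqrt_mul_self (abs_nonneg _)]
  rw [gaussianDensity, gaussianDensity, hq, hd, det_one, Real.one_rpow]
  ring

theorem measurable_gaussianDensity (S : Matrix ι ι ℝ) : Measurable (gaussianDensity S) := by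
  unfold gaussianDensity quadForm dotProduct mulVec dotProduct
  fun_prop

theorem gaussianDensity_nonneg {S : Matrix ι ι ℝ} (hS : S.PosDef) (x : ι → ℝ) :
    0 ≤ gaussianDensity S x := by
  have := hS.det_pos
  unfold gaussianDensity
  positivity

/-- Integrals against a centred Gaussian density reduce to the standard Gaussian law. -/
theorem lintegral_gaussianDensity_mul {L : Matrix ι ι ℝ} (hL : L.det ≠ 0)
    {g : (ι → ℝ) → ℝ≥0∞} (hg : Measurable g) :
    ∫⁻ x, ENNReal.ofReal (gaussianDensity (L * Lᵀ) x) * g x =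
      ∫⁻ z, g (L *ᵥ z) ∂(Measure.pi fun _ : ι => gaussianReal 0 1) := by
  have hmeas : Measurable fun x => ENNReal.ofReal (gaussianDensity (L * Lᵀ) x) * g x :=
    (measurable_gaussianDensity _).ennreal_ofReal.mul hg
  have hLm : Measurable fun z : ι → ℝ => L *ᵥ z := by
    unfold mulVec dotProduct
    fun_prop
  have hvol : (volume : Measure (ι → ℝ)) =
      ENNReal.ofReal |L.det| • volume.map (fun z => L *ᵥ z) := by
    have := Real.map_matrix_volume_pi_eq_smul_volume_pi hL
    rw [show (fun z : ι → ℝ => L *ᵥ z) = toLin' L from rfl, this, smul_smul,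
      ← ENNReal.ofReal_mul (abs_nonneg _), abs_inv, mul_inv_cancel₀ (abs_ne_zero.2 hL),
      ENNReal.ofReal_one, one_smul]
  rw [hvol, lintegral_smul_measure, lintegral_map hmeas hLm, pi_gaussianReal_eq_withDensity,
    lintegral_withDensity_eq_lintegral_mul _ (measurable_gaussianDensity _).ennreal_ofReal
      (show Measurable fun z => g (L *ᵥ z) from hg.comp hLm), smul_eq_mul,
    ← lintegral_const_mul' _ _ ENNReal.ofReal_ne_top]
  refine lintegral_congr fun z => ?_
  rw [gaussianDensity_mul_transpose_mulVec hL, Pi.mul_apply, ← mul_assoc,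
    ← ENNReal.ofReal_mul (abs_nonneg _), ← mul_assoc, mul_inv_cancel₀ (abs_ne_zero.2 hL), one_mul]

/-- Writing S = L Lᵀ and x = L z + μ reduces to a standard Gaussian z with direction Lᵀβ, whose
squared norm is βᵀSβ. -/
theorem lintegral_gaussianDensity_mul_normalCdf {S : Matrix ι ι ℝ} (hS : S.PosDef)
    (μ β : ι → ℝ) (a : ℝ) :
    ∫⁻ x, ENNReal.ofReal (gaussianDensity S (x - μ) * normalCdf (a + β ⬝ᵥ (x - μ))) =
      ENNReal.ofReal (normalCdf (a / √(1 + quadForm S β))) := by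
  rw [lintegral_sub_right_eq_self
    (fun x => ENNReal.ofReal (gaussianDensity S x * normalCdf (a + β ⬝ᵥ x))) μ]
  simp_rw [ENNReal.ofReal_mul (gaussianDensity_nonneg hS _)]
  obtain ⟨L, hL, rfl⟩ := exists_mul_transpose_eq hS
  rw [lintegral_gaussianDensity_mul hL (by unfold dotProduct; fun_prop), quadForm_mul_transpose,
    ← lintegral_normalCdf_pi_gaussianReal]
  simp_rw [dotProduct_mulVec, ← mulVec_transpose]

end NormalCdf

/-! ### Schur complements and marginals of the skew-normal density. -/

section SchurComplement

variable {m d : ℕ} {R : Matrix (Fin m ⊕ Fin d) (Fin m ⊕ Fin d) ℝ}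

theorem posDef_toBlocks₂₂ (hR : R.PosDef) : R.toBlocks₂₂.PosDef :=
  hR.submatrix Sum.inr_injective

theorem toBlocks₂₁_eq_transpose (hR : R.PosDef) : R.toBlocks₂₁ = (R.toBlocks₁₂)ᵀ := by
  ext i j
  exact (hR.isHermitian.apply (Sum.inr i) (Sum.inl j)).symm

theorem det_eq_mul_det_schur (hR : R.PosDef) : R.det = R.toBlocks₂₂.det * (schur R).det := by
  have := (posDef_toBlocks₂₂ hR).isUnit.invertible
  conv_lhs => rw [← fromBlocks_toBlocks R, det_fromBlocks₂₂, invOf_eq_nonsing_inv]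
  rfl

theorem transpose_toBlocks₂₂_inv (hR : R.PosDef) :
    ((R.toBlocks₂₂)⁻¹)ᵀ = (R.toBlocks₂₂)⁻¹ := by
  rw [← conjTranspose_eq_transpose_of_trivial]
  exact (posDef_toBlocks₂₂ hR).inv.isHermitian

theorem posDef_schur (hR : R.PosDef) : (schur R).PosDef := by
  have hD := posDef_toBlocks₂₂ hR
  have := hD.isUnit.invertible
  have hB : R.toBlocks₂₁ = (R.toBlocks₁₂)ᴴ := by
    rw [toBlocks₂₁_eq_transpose hR, conjTranspose_eq_transpose_of_trivial]
  have hR' : (fromBlocks R.toBlocks₁₁ R.toBlocks₁₂ (R.toBlocks₁₂)ᴴ R.toBlocks₂₂).PosDef := by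
    rw [← hB, fromBlocks_toBlocks]
    exact hR
  refine .of_dotProduct_mulVec_pos ?_ fun x hx => ?_
  · rw [schur, hB]
    exact (IsHermitian.fromBlocks₂₂ _ _ hD.isHermitian).1 hR'.isHermitian
  -- The second block -D⁻¹Bᴴx minimizes the form of `R` over vectors with first block x: the
  -- completed square vanishes and the Schur form remains.
  · have h := schur_complement_eq₂₂ R.toBlocks₁₁ R.toBlocks₁₂ (D := R.toBlocks₂₂) x
      (-(((R.toBlocks₂₂)⁻¹ * (R.toBlocks₁₂)ᴴ) *ᵥ x)) hD.isHermitian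
    rw [add_neg_cancel, dotProduct_zero, zero_add, ← dotProduct_mulVec, ← dotProduct_mulVec,
      ← hB] at h
    rw [schur, ← h, hB]
    refine hR'.dotProduct_mulVec_pos fun h0 => hx ?_
    ext i
    exact congrFun h0 (Sum.inl i)

theorem quadForm_inv_sumElim (hR : R.PosDef) (x : Fin m → ℝ) (y : Fin d → ℝ) :
    quadForm R⁻¹ (Sum.elim x y) =
      quadForm (schur R)⁻¹ (x - condLocation R y) + quadForm (R.toBlocks₂₂)⁻¹ y := by
  set D := R.toBlocks₂₂ with hD
  set B := R.toBlocks₁₂ with hB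
  -- Block elimination for R w = (x, y): the Schur complement yields w₁, and back-substitution
  -- yields w₂. This avoids a block formula for R⁻¹.
  obtain ⟨w₁, hw₁⟩ : ∃ w, w = (schur R)⁻¹ *ᵥ (x - condLocation R y) := ⟨_, rfl⟩
  obtain ⟨w₂, hw₂⟩ : ∃ w, w = D⁻¹ *ᵥ (y - Bᵀ *ᵥ w₁) := ⟨_, rfl⟩
  have hDu : IsUnit D.det := (isUnit_iff_isUnit_det _).1 (posDef_toBlocks₂₂ hR).isUnit
  have hSu : IsUnit (schur R).det := (isUnit_iff_isUnit_det _).1 (posDef_schur hR).isUnit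
  have hRu : IsUnit R.det := (isUnit_iff_isUnit_det _).1 hR.isUnit
  have hS : schur R *ᵥ w₁ = x - condLocation R y := by
    rw [hw₁, mulVec_mulVec, mul_nonsing_inv _ hSu, one_mulVec]
  have hRw : R *ᵥ Sum.elim w₁ w₂ = Sum.elim x y := by
    conv_lhs => rw [← fromBlocks_toBlocks R, toBlocks₂₁_eq_transpose hR, ← hD, ← hB]
    rw [fromBlocks_mulVec]
    congr 1
    · have : R.toBlocks₁₁ = schur R + B * D⁻¹ * Bᵀ := by
        rw [schur, toBlocks₂₁_eq_transpose hR, sub_add_cancel]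
      simp only [Sum.elim_comp_inl, Sum.elim_comp_inr]
      rw [this, add_mulVec, hS, hw₂, condLocation, ← hD, ← hB, mulVec_mulVec, mulVec_sub,
        mulVec_mulVec]
      abel
    · simp only [Sum.elim_comp_inl, Sum.elim_comp_inr]
      rw [hw₂, mulVec_mulVec, mul_nonsing_inv _ hDu, one_mulVec]
      abel
  have hinv : R⁻¹ *ᵥ Sum.elim x y = Sum.elim w₁ w₂ := by
    rw [← hRw, mulVec_mulVec, nonsing_inv_mul _ hRu, one_mulVec]
  have hcross : y ⬝ᵥ D⁻¹ *ᵥ Bᵀ *ᵥ w₁ = condLocation R y ⬝ᵥ w₁ := by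
    rw [condLocation, ← hD, ← hB, dotProduct_mulVec, dotProduct_mulVec, ← mulVec_transpose,
      ← mulVec_transpose, transpose_transpose, transpose_toBlocks₂₂_inv hR, mulVec_mulVec]
  rw [quadForm, hinv, sumElim_dotProduct_sumElim, hw₂, mulVec_sub, dotProduct_sub, hcross,
    quadForm, quadForm, ← hw₁, sub_dotProduct]
  ring

theorem gaussianDensity_sumElim (hR : R.PosDef) (x : Fin m → ℝ) (y : Fin d → ℝ) :
    gaussianDensity R (Sum.elim x y) =
      gaussianDensity R.toBlocks₂₂ y * gaussianDensity (schur R) (x - condLocation R y) := by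
  have h1 := (posDef_toBlocks₂₂ hR).det_pos
  have h2 := (posDef_schur hR).det_pos
  have hpi : (0 : ℝ) < 2 * Real.pi := by positivity
  simp only [gaussianDensity, det_eq_mul_det_schur hR, quadForm_inv_sumElim hR, Fintype.card_sum,
    Fintype.card_fin, Real.mul_rpow h1.le h2.le]
  rw [show -(quadForm (schur R)⁻¹ (x - condLocation R y) + quadForm (R.toBlocks₂₂)⁻¹ y) / 2 =
    -quadForm (R.toBlocks₂₂)⁻¹ y / 2 + -quadForm (schur R)⁻¹ (x - condLocation R y) / 2 by ring,
    Real.exp_add, show -((m + d : ℕ) : ℝ) / 2 = -(d : ℝ) / 2 + -(m : ℝ) / 2 by push_cast; ring,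
    Real.rpow_add hpi]
  ring

/-- The unnormalized slant `α_s + Ω_s⁻¹ Ω_st α_t` of the marginal law. -/
noncomputable def margDirection (R : Matrix (Fin m ⊕ Fin d) (Fin m ⊕ Fin d) ℝ)
    (α : Fin m ⊕ Fin d → ℝ) : Fin d → ℝ :=
  α ∘ Sum.inr + ((R.toBlocks₂₂)⁻¹ * R.toBlocks₂₁) *ᵥ (α ∘ Sum.inl)

/-- The scaling factor `√(1 + α_tᵀ Ω̃ α_t)` of the slant and extension of the marginal law. -/
noncomputable def margScale (R : Matrix (Fin m ⊕ Fin d) (Fin m ⊕ Fin d) ℝ)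
    (α : Fin m ⊕ Fin d → ℝ) : ℝ :=
  √(1 + quadForm (schur R) (α ∘ Sum.inl))

theorem quadForm_nonneg {ι : Type*} [Fintype ι] {S : Matrix ι ι ℝ}
    (hS : S.PosDef) (x : ι → ℝ) : 0 ≤ quadForm S x :=
  hS.posSemidef.dotProduct_mulVec_nonneg x

theorem quadForm_pos {ι : Type*} [Fintype ι] {S : Matrix ι ι ℝ}
    (hS : S.PosDef) {x : ι → ℝ} (hx : x ≠ 0) : 0 < quadForm S x :=
  hS.dotProduct_mulVec_pos hx

theorem margScale_pos (hR : R.PosDef) (α : Fin m ⊕ Fin d → ℝ) : 0 < margScale R α := by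
  have := quadForm_nonneg (posDef_schur hR) (α ∘ Sum.inl)
  unfold margScale
  positivity

/-- Centring x at its conditional mean given y moves the part of α_t explained by y into the
marginal slant. -/
theorem dotProduct_sumElim (hR : R.PosDef) (α : Fin m ⊕ Fin d → ℝ) (x : Fin m → ℝ)
    (y : Fin d → ℝ) :
    α ⬝ᵥ Sum.elim x y =
      (α ∘ Sum.inl) ⬝ᵥ (x - condLocation R y) + margDirection R α ⬝ᵥ y := by
  have h : (α ∘ Sum.inl) ⬝ᵥ condLocation R y =
      (((R.toBlocks₂₂)⁻¹ * R.toBlocks₂₁) *ᵥ (α ∘ Sum.inl)) ⬝ᵥ y := by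
    rw [condLocation, dotProduct_mulVec, ← mulVec_transpose, transpose_mul,
      transpose_toBlocks₂₂_inv hR, toBlocks₂₁_eq_transpose hR]
  conv_lhs => rw [← Sum.elim_comp_inl_inr α, sumElim_dotProduct_sumElim]
  rw [dotProduct_sub, h, margDirection, add_dotProduct]
  ring

/-- Given y, the first block is Gaussian with covariance Ω̃, so averaging Φ over it divides the
argument by √(1 + α_tᵀΩ̃α_t). -/
theorem lintegral_extSkew_sumElim (hR : R.PosDef) (α : Fin m ⊕ Fin d → ℝ) (τ : ℝ)
    (y : Fin d → ℝ) :
    ∫⁻ x, ENNReal.ofReal (gaussianDensity R (Sum.elim x y) *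
        normalCdf (α ⬝ᵥ Sum.elim x y + τ)) =
      ENNReal.ofReal (gaussianDensity R.toBlocks₂₂ y *
        normalCdf (((margScale R α)⁻¹ • margDirection R α) ⬝ᵥ y + τ / margScale R α)) := by
  have h0 := gaussianDensity_nonneg (posDef_toBlocks₂₂ hR) y
  simp_rw [gaussianDensity_sumElim hR, dotProduct_sumElim hR, mul_assoc,
    ENNReal.ofReal_mul h0]
  rw [lintegral_const_mul' _ _ ENNReal.ofReal_ne_top]
  have := lintegral_gaussianDensity_mul_normalCdf (posDef_schur hR) (condLocation R y)
    (α ∘ Sum.inl) (margDirection R α ⬝ᵥ y + τ)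
  congr 1
  rw [smul_dotProduct, smul_eq_mul, ← div_eq_inv_mul, ← add_div, margScale, ← this]
  refine lintegral_congr fun x => ?_
  congr 3
  ring

end SchurComplement

/-! ### The radial integral and the non-central t cdf. -/

section RadialIntegral

/-- The integrand of `radialIntegral`. -/
noncomputable def radialIntegrand (p q a τ r : ℝ) : ℝ :=
  r ^ (p - 1) * Real.exp (-(r ^ 2 * q) / 2) * normalCdf (r * a + τ)

/-- The integral `∫₀^∞ r^{p-1} exp(-r² q / 2) Φ(r a + τ) dr`. -/
noncomputable def radialIntegral (p q a τ : ℝ) : ℝ :=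
  ∫ r in Set.Ioi 0, radialIntegrand p q a τ r

@[fun_prop]
theorem measurable_uncurry_radialIntegrand (p τ : ℝ) :
    Measurable fun z : (ℝ × ℝ) × ℝ => radialIntegrand p z.1.1 z.1.2 τ z.2 := by
  unfold radialIntegrand
  fun_prop

theorem measurable_radialIntegrand (p q a τ : ℝ) : Measurable (radialIntegrand p q a τ) := by
  unfold radialIntegrand
  fun_prop

theorem radialIntegrand_pos (p q a τ : ℝ) {r : ℝ} (hr : 0 < r) :
    0 < radialIntegrand p q a τ r := by
  have := normalCdf_pos (r * a + τ)
  unfold radialIntegrand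
  positivity

/-- The bound does not involve a and is uniform over q ≥ q', so it serves both integrability and
dominated convergence. -/
theorem radialIntegrand_le (p a τ : ℝ) {q q' r : ℝ} (hq : q' ≤ q) (hr : 0 < r) :
    radialIntegrand p q a τ r ≤ r ^ (p - 1) * Real.exp (-(q' / 2) * r ^ 2) := by
  have h1 := normalCdf_nonneg (r * a + τ)
  have h2 : Real.exp (-(r ^ 2 * q) / 2) ≤ Real.exp (-(q' / 2) * r ^ 2) := by
    refine Real.exp_le_exp.2 ?_
    nlinarith [sq_nonneg r]
  calc _ ≤ r ^ (p - 1) * Real.exp (-(q' / 2) * r ^ 2) * 1 := by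
        unfold radialIntegrand
        gcongr
        exact normalCdf_le_one _
    _ = _ := mul_one _

theorem integrableOn_radialBound {p q : ℝ} (hp : 0 < p) (hq : 0 < q) :
    IntegrableOn (fun r : ℝ => r ^ (p - 1) * Real.exp (-(q / 2) * r ^ 2)) (Set.Ioi 0) :=
  integrableOn_rpow_mul_exp_neg_mul_sq (by positivity) (by linarith)

theorem integrableOn_radialIntegrand {p q : ℝ} (hp : 0 < p) (hq : 0 < q) (a τ : ℝ) :
    IntegrableOn (radialIntegrand p q a τ) (Set.Ioi 0) := by
  refine (integrableOn_radialBound hp hq).mono'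
    (measurable_radialIntegrand p q a τ).aestronglyMeasurable ?_
  filter_upwards [ae_restrict_mem measurableSet_Ioi] with r hr
  rw [Real.norm_of_nonneg (radialIntegrand_pos p q a τ hr).le]
  exact radialIntegrand_le p a τ le_rfl hr

theorem radialIntegral_nonneg (p q a τ : ℝ) : 0 ≤ radialIntegral p q a τ :=
  setIntegral_nonneg measurableSet_Ioi fun _ hr => (radialIntegrand_pos p q a τ hr).le

theorem radialIntegral_pos {p q : ℝ} (hp : 0 < p) (hq : 0 < q) (a τ : ℝ) :
    0 < radialIntegral p q a τ := by
  rw [radialIntegral, setIntegral_pos_iff_support_of_nonneg_ae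
    ((ae_restrict_mem measurableSet_Ioi).mono fun r hr => (radialIntegrand_pos p q a τ hr).le)
    (integrableOn_radialIntegrand hp hq a τ)]
  have : Set.Ioi (0 : ℝ) ⊆ Function.support (radialIntegrand p q a τ) := fun r hr =>
    (radialIntegrand_pos p q a τ hr).ne'
  simp [Set.inter_eq_self_of_subset_right this]

theorem lintegral_radialIntegrand {p q : ℝ} (hp : 0 < p) (hq : 0 < q) (a τ : ℝ) :
    ∫⁻ r in Set.Ioi 0, ENNReal.ofReal (radialIntegrand p q a τ r) =
      ENNReal.ofReal (radialIntegral p q a τ) :=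
  (ofReal_integral_eq_lintegral_ofReal (integrableOn_radialIntegrand hp hq a τ)
    ((ae_restrict_mem measurableSet_Ioi).mono
      fun _ hr => (radialIntegrand_pos p q a τ hr).le)).symm

theorem measurable_radialIntegral (p τ : ℝ) :
    Measurable fun z : ℝ × ℝ => radialIntegral p z.1 z.2 τ :=
  ((measurable_uncurry_radialIntegrand p τ).stronglyMeasurable.integral_prod_right'
    (ν := volume.restrict (Set.Ioi 0))).measurable

theorem continuousAt_radialIntegral {p : ℝ} (hp : 0 < p) (τ : ℝ) {z : ℝ × ℝ} (hz : 0 < z.1) :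
    ContinuousAt (fun z : ℝ × ℝ => radialIntegral p z.1 z.2 τ) z := by
  refine continuousAt_of_dominated
    (bound := fun r => r ^ (p - 1) * Real.exp (-((z.1 / 2) / 2) * r ^ 2)) ?_ ?_
    (integrableOn_radialBound hp (half_pos hz)) ?_
  · exact .of_forall fun w => (measurable_radialIntegrand p w.1 w.2 τ).aestronglyMeasurable
  · have : ∀ᶠ w : ℝ × ℝ in nhds z, z.1 / 2 < w.1 :=
      continuous_fst.continuousAt.eventually (lt_mem_nhds (half_lt_self hz))
    filter_upwards [this] with w hw
    filter_upwards [ae_restrict_mem measurableSet_Ioi] with r hr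
    rw [Real.norm_of_nonneg (radialIntegrand_pos p w.1 w.2 τ hr).le]
    exact radialIntegrand_le p w.2 τ hw.le hr
  · refine ae_of_all _ fun r => Continuous.continuousAt ?_
    unfold radialIntegrand
    fun_prop

/-- Condition on the χ² variable: for v > 0, (Z + κ) / √(v / p) ≤ x means Z ≤ x √(v / p) - κ. -/
theorem noncentralT_Iic {p : ℝ} (hp : 0 < p) (x κ : ℝ) :
    noncentralT κ p (Set.Iic x) = ∫⁻ v in Set.Ioi 0, gammaPDF (p / 2) (1 / 2) v *
      ENNReal.ofReal (normalCdf (x * √(v / p) - κ)) := by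
  have := isProbabilityMeasure_gammaMeasure (half_pos hp) (one_half_pos (α := ℝ))
  have hm : Measurable fun z : ℝ × ℝ => (z.1 + κ) / √(z.2 / p) := by fun_prop
  have hm' : Measurable fun v => gammaPDF (p / 2) (1 / 2) v :=
    (measurable_gammaPDFReal _ _).ennreal_ofReal
  have hset : MeasurableSet ((fun z : ℝ × ℝ => (z.1 + κ) / √(z.2 / p)) ⁻¹' Set.Iic x) :=
    hm measurableSet_Iic
  have hset : MeasurableSet ((fun z : ℝ × ℝ => (z.1 + κ) / √(z.2 / p)) ⁻¹' Set.Iic x) :=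
    hm measurableSet_Iic
  rw [noncentralT, Measure.map_apply hm measurableSet_Iic, Measure.prod_apply_symm hset,
    gammaMeasure, lintegral_withDensity_eq_lintegral_mul _ hm'
      (measurable_measure_prodMk_right hset), ← lintegral_indicator measurableSet_Ioi]
  refine lintegral_congr_ae ?_
  -- At v = 0 the quotient has the default value 0, so this null point is dropped; for v < 0 the
  -- Gamma density vanishes.
  filter_upwards [Measure.ae_ne volume (0 : ℝ)] with v hv
  rcases lt_or_gt_of_ne hv with hv | hv
  · rw [Set.indicator_of_notMem (by simpa using hv.le), Pi.mul_apply, gammaPDF_of_neg hv, zero_mul]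
  · rw [Set.indicator_of_mem (by simpa using hv), Pi.mul_apply, ofReal_normalCdf]
    congr 2
    ext z
    have : 0 < √(v / p) := by positivity
    simp [div_le_iff₀ this, le_sub_iff_add_le]

/-- Under v = r² q, the factor r^{p-1} exp(-r² q / 2) dr becomes a multiple of the χ²_p density, and
a √(p / q) √(v / p) = r a. The sign of τ flips because Φ(r a + τ) must match Φ(r a - κ). -/
theorem radialIntegral_eq {p q : ℝ} (hp : 0 < p) (hq : 0 < q) (a τ : ℝ) :
    radialIntegral p q a τ = 2 ^ (p / 2 - 1) * Real.Gamma (p / 2) * q ^ (-(p / 2)) *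
      noncentralTCdf (a * √(p / q)) (-τ) p := by
  have hG : 0 < Real.Gamma (p / 2) := Real.Gamma_pos_of_pos (half_pos hp)
  set C := 2 ^ (p / 2 - 1) * Real.Gamma (p / 2) * q ^ (-(p / 2)) with hCdef
  have hC : 0 < C := by positivity
  have himage : (fun r : ℝ => r ^ 2 * q) '' Set.Ioi 0 = Set.Ioi 0 := by
    ext v
    constructor
    · rintro ⟨r, hr, rfl⟩
      have : 0 < r := hr
      exact (by positivity : 0 < r ^ 2 * q)
    · intro hv
      have hv' : 0 < v := hv
      refine ⟨√(v / q), Set.mem_Ioi.2 (by positivity), ?_⟩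
      simp only
      rw [Real.sq_sqrt (by positivity)]
      field_simp
  have hinj : Set.InjOn (fun r : ℝ => r ^ 2 * q) (Set.Ioi 0) := fun r hr r' hr' h =>
    (pow_left_inj₀ (le_of_lt hr) (le_of_lt hr') two_ne_zero).1 (mul_right_cancel₀ hq.ne' h)
  have hderiv : ∀ r ∈ Set.Ioi (0 : ℝ),
      HasDerivWithinAt (fun r : ℝ => r ^ 2 * q) (2 * r * q) (Set.Ioi 0) r := fun r _ => by
    simpa using ((hasDerivAt_pow 2 r).mul_const q).hasDerivWithinAt
  have hpt : ∀ r ∈ Set.Ioi (0 : ℝ), ENNReal.ofReal |2 * r * q| *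
      (gammaPDF (p / 2) (1 / 2) (r ^ 2 * q) * ENNReal.ofReal
        (normalCdf (a * √(p / q) * √(r ^ 2 * q / p) - -τ))) =
      ENNReal.ofReal C⁻¹ * ENNReal.ofReal (radialIntegrand p q a τ r) := by
    intro r hr
    have hr : 0 < r := hr
    have hn := normalCdf_nonneg (r * a + τ)
    have harg : a * √(p / q) * √(r ^ 2 * q / p) - -τ = r * a + τ := by
      rw [mul_assoc, ← Real.sqrt_mul (by positivity),
        show p / q * (r ^ 2 * q / p) = r ^ 2 by field_simp, Real.sqrt_sq hr.le]
      ring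
    rw [harg, gammaPDF, gammaPDFReal, if_pos (by positivity), abs_of_pos (by positivity),
      ← ENNReal.ofReal_mul (by positivity), ← ENNReal.ofReal_mul (by positivity),
      ← ENNReal.ofReal_mul (by positivity)]
    congr 1
    have hrp : (r ^ 2 * q) ^ (p / 2 - 1) = r ^ (p - 1) / r * (q ^ (p / 2) / q) := by
      rw [Real.mul_rpow (by positivity) hq.le, ← Real.rpow_natCast, ← Real.rpow_mul hr.le,
        ← Real.rpow_sub_one hr.ne', ← Real.rpow_sub_one hq.ne']
      congr 2
      push_cast
      ring
    rw [hrp, radialIntegrand, hCdef, Real.rpow_neg hq.le, Real.rpow_sub_one two_ne_zero,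
      Real.div_rpow zero_le_one zero_le_two, Real.one_rpow,
      show -(1 / 2 * (r ^ 2 * q)) = -(r ^ 2 * q) / 2 by ring]
    field_simp
  have h : noncentralTCdf (a * √(p / q)) (-τ) p = C⁻¹ * radialIntegral p q a τ := by
    rw [noncentralTCdf, measureReal_def, noncentralT_Iic hp, ← himage,
      lintegral_image_eq_lintegral_abs_deriv_mul measurableSet_Ioi hderiv hinj,
      setLIntegral_congr_fun measurableSet_Ioi hpt,
      lintegral_const_mul' _ _ ENNReal.ofReal_ne_top, lintegral_radialIntegrand hp hq,
      ← ENNReal.ofReal_mul (by positivity), ENNReal.toReal_ofReal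
        (mul_nonneg (by positivity) (radialIntegral_nonneg _ _ _ _))]
  rw [h, mul_inv_cancel_left₀ hC.ne']

end RadialIntegral

/-! ### Signed powers on the real line. -/

section SignedPow

theorem signedPow_zero (p : ℝ) : signedPow 0 p = 0 := by simp [signedPow]

theorem signedPow_of_pos {x : ℝ} (hx : 0 < x) (p : ℝ) : signedPow x p = x ^ p := by
  rw [signedPow, Real.sign_of_pos hx, abs_of_pos hx, one_mul]

theorem signedPow_neg (x p : ℝ) : signedPow (-x) p = -signedPow x p := by
  rw [signedPow, signedPow, Real.sign_neg, abs_neg, neg_mul]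

theorem signedPow_pos {x : ℝ} (hx : 0 < x) (p : ℝ) : 0 < signedPow x p := by
  rw [signedPow_of_pos hx]
  positivity

theorem signedPow_signedPow (x : ℝ) {p q : ℝ} (hpq : p * q = 1) :
    signedPow (signedPow x p) q = x := by
  have hpos : ∀ {x : ℝ}, 0 < x → signedPow (signedPow x p) q = x := fun {x} hx => by
    rw [signedPow_of_pos hx, signedPow_of_pos (by positivity), ← Real.rpow_mul hx.le, hpq,
      Real.rpow_one]
  rcases lt_trichotomy x 0 with hx | rfl | hx
  · have := hpos (neg_pos.2 hx)
    rwa [signedPow_neg, signedPow_neg, neg_inj] at this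
  · rw [signedPow_zero, signedPow_zero]
  · exact hpos hx

theorem signedPow_mul {c : ℝ} (hc : 0 < c) (x p : ℝ) :
    signedPow (c * x) p = c ^ p * signedPow x p := by
  have : Real.sign (c * x) = Real.sign x := by
    rcases lt_trichotomy x 0 with h | rfl | h
    · rw [Real.sign_of_neg h, Real.sign_of_neg (mul_neg_of_pos_of_neg hc h)]
    · rw [mul_zero]
    · rw [Real.sign_of_pos h, Real.sign_of_pos (mul_pos hc h)]
  rw [signedPow, signedPow, this, abs_mul, abs_of_pos hc, Real.mul_rpow hc.le (abs_nonneg x)]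
  ring

theorem signedPow_ne_zero {x : ℝ} (hx : x ≠ 0) (p : ℝ) : signedPow x p ≠ 0 := by
  rcases hx.lt_or_gt with h | h
  · have := signedPow_pos (neg_pos.2 h) p
    rw [signedPow_neg] at this
    exact (neg_pos.1 this).ne
  · exact (signedPow_pos h p).ne'

theorem hasDerivAt_signedPow {x : ℝ} (hx : x ≠ 0) (p : ℝ) :
    HasDerivAt (fun x => signedPow x p) (p * |x| ^ (p - 1)) x := by
  have hpos : ∀ {x : ℝ}, 0 < x → HasDerivAt (fun x => signedPow x p) (p * |x| ^ (p - 1)) x :=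
    fun {x} hx => by
      rw [abs_of_pos hx]
      refine (Real.hasDerivAt_rpow_const (.inl hx.ne')).congr_of_eventuallyEq ?_
      filter_upwards [lt_mem_nhds hx] with y hy using signedPow_of_pos hy p
  rcases hx.lt_or_gt with h | h
  · have h1 := ((hpos (neg_pos.2 h)).comp x (hasDerivAt_neg x)).neg
    rw [abs_neg, mul_neg_one, neg_neg] at h1
    refine h1.congr_of_eventuallyEq (.of_forall fun y => ?_)
    rw [Pi.neg_apply, Function.comp_apply, signedPow_neg, neg_neg]
  · exact hpos h

theorem continuous_signedPow {p : ℝ} (hp : 0 < p) : Continuous fun x => signedPow x p := by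
  refine continuous_iff_continuousAt.2 fun x => ?_
  rcases eq_or_ne x 0 with rfl | hx
  · have h0 : Filter.Tendsto (fun x : ℝ => |x| ^ p) (nhds 0) (nhds 0) := by
      have : Continuous fun x : ℝ => |x| ^ p := continuous_abs.rpow_const fun _ => .inr hp.le
      simpa [Real.zero_rpow hp.ne'] using this.tendsto 0
    rw [ContinuousAt, signedPow_zero]
    refine squeeze_zero_norm (fun y => ?_) h0
    rcases Real.sign_apply_eq y with h | h | h <;>
      simp [signedPow, h, abs_of_nonneg (Real.rpow_nonneg (abs_nonneg y) p)]
    positivity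
  · exact (hasDerivAt_signedPow hx p).continuousAt

/-- The density is the derivative of the inverse map v ↦ (v c)^{1/ν}. The origin, where that
derivative may fail to exist, is removed as a null set. -/
theorem map_signedPow_volume {ν c : ℝ} (hν : 0 < ν) (hc : 0 < c) :
    (volume : Measure ℝ).map (fun y => signedPow y ν / c) =
      volume.withDensity fun v => ENNReal.ofReal (ν⁻¹ * (c * |v| ^ (1 - ν)) ^ (1 / ν)) := by
  have hT : Measurable fun y => signedPow y ν / c :=
    ((continuous_signedPow hν).div_const c).measurable
  have hinv : ∀ y, signedPow (signedPow y ν / c * c) (1 / ν) = y := fun y => by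
    rw [div_mul_cancel₀ _ hc.ne', signedPow_signedPow _ (mul_one_div_cancel hν.ne')]
  have hinv' : ∀ v, signedPow (signedPow (v * c) (1 / ν)) ν / c = v := fun v => by
    rw [signedPow_signedPow _ (one_div_mul_cancel hν.ne'), mul_div_cancel_right₀ _ hc.ne']
  ext A hA
  have himage : (fun v => signedPow (v * c) (1 / ν)) '' (A \ {0}) =
      ((fun y => signedPow y ν / c) ⁻¹' A) \ {0} := by
    ext y
    constructor
    · rintro ⟨v, ⟨hv, hv0⟩, rfl⟩
      refine ⟨?_, signedPow_ne_zero (mul_ne_zero hv0 hc.ne') _⟩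
      rw [Set.mem_preimage, hinv']
      exact hv
    · rintro ⟨hy, hy0⟩
      exact ⟨_, ⟨hy, div_ne_zero (signedPow_ne_zero hy0 ν) hc.ne'⟩, hinv y⟩
  have hderiv : ∀ v ∈ A \ {0}, HasDerivWithinAt (fun v => signedPow (v * c) (1 / ν))
      (1 / ν * |v * c| ^ (1 / ν - 1) * c) (A \ {0}) v := fun v hv =>
    HasDerivAt.hasDerivWithinAt <| HasDerivAt.comp (h₂ := fun x => signedPow x (1 / ν)) v
      (hasDerivAt_signedPow (mul_ne_zero hv.2 hc.ne') (1 / ν)) (hasDerivAt_mul_const c)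
  have hinj : Set.InjOn (fun v => signedPow (v * c) (1 / ν)) (A \ {0}) := fun v _ w _ h => by
    rw [← hinv' v, ← hinv' w]
    exact congrArg (fun z => signedPow z ν / c) h
  have hnull : ∀ B : Set ℝ, (B \ {0} : Set ℝ) =ᵐ[volume] B := fun B =>
    sdiff_null_ae_eq_self (measure_singleton 0)
  have h := lintegral_image_eq_lintegral_abs_deriv_mul (hA.diff (measurableSet_singleton 0))
    hderiv hinj (fun _ => 1)
  rw [himage, setLIntegral_one, measure_congr (hnull _)] at h
  rw [Measure.map_apply hT hA, h, withDensity_apply _ hA, ← setLIntegral_congr (hnull A)]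
  refine setLIntegral_congr_fun (hA.diff (measurableSet_singleton 0)) fun v hv => ?_
  have hv0 : 0 < |v| := abs_pos.2 hv.2
  simp only [mul_one]
  congr 1
  rw [abs_mul v c, abs_of_pos hc, abs_of_nonneg (by positivity),
    Real.mul_rpow hv0.le hc.le, Real.mul_rpow hc.le (by positivity), ← Real.rpow_mul hv0.le,
    show (1 - ν) * (1 / ν) = 1 / ν - 1 by field_simp, Real.rpow_sub_one hc.ne']
  field_simp

end SignedPow

/-! ### The coordinatewise transformation v ↦ v° and its Jacobian. -/

section CoordinatewisePow

variable {ι : Type*}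

/-- The inverse of the transformation `circ`. -/
noncomputable def circInv (ν : ℝ) (mp y : ι → ℝ) : ι → ℝ :=
  fun i => signedPow (y i) ν / mp i

variable {ν : ℝ} {mp : ι → ℝ}

theorem circ_circInv (hν : 0 < ν) (hmp : ∀ i, 0 < mp i) (y : ι → ℝ) :
    circ ν mp (circInv ν mp y) = y := by
  ext i
  rw [circ, circInv, div_mul_cancel₀ _ (hmp i).ne',
    signedPow_signedPow _ (mul_one_div_cancel hν.ne')]

theorem continuous_circ (hν : 0 < ν) : Continuous (circ ν mp) :=
  continuous_pi fun i => (continuous_signedPow (by positivity)).comp (by fun_prop)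

theorem continuous_circInv (hν : 0 < ν) : Continuous (circInv ν mp) :=
  continuous_pi fun i => ((continuous_signedPow hν).comp (continuous_apply i)).div_const _

theorem circ_ne_zero (hmp : ∀ i, 0 < mp i) {v : ι → ℝ} (hv : v ≠ 0) : circ ν mp v ≠ 0 := by
  obtain ⟨i, hi⟩ := Function.ne_iff.1 hv
  exact fun h => signedPow_ne_zero (mul_ne_zero hi (hmp i).ne') (1 / ν) (congrFun h i)

/-- This homogeneity is what lets the mixing variable ζ = r^{-ν} be absorbed into a rescaling of the
process values. -/
theorem circInv_smul {r : ℝ} (hr : 0 < r) (y : ι → ℝ) :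
    circInv ν mp (r • y) = r ^ ν • circInv ν mp y := by
  ext i
  simp only [circInv, Pi.smul_apply, smul_eq_mul, signedPow_mul hr, mul_div_assoc]

variable [Fintype ι]

/-- The Jacobian of the transformation `circ`. -/
noncomputable def circJacobian (ν : ℝ) (mp v : ι → ℝ) : ℝ :=
  ∏ i, ν⁻¹ * (mp i * |v i| ^ (1 - ν)) ^ (1 / ν)

theorem circJacobian_nonneg (hν : 0 < ν) (hmp : ∀ i, 0 < mp i) (v : ι → ℝ) :
    0 ≤ circJacobian ν mp v :=
  Finset.prod_nonneg fun i _ => by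
    have := hmp i
    positivity

theorem circJacobian_pos (hν : 0 < ν) (hmp : ∀ i, 0 < mp i) {v : ι → ℝ} (hv : ∀ i, v i ≠ 0) :
    0 < circJacobian ν mp v :=
  Finset.prod_pos fun i _ => by
    have := hmp i
    have := abs_pos.2 (hv i)
    positivity

theorem measurable_circJacobian : Measurable (circJacobian ν mp) := by
  unfold circJacobian
  fun_prop

/-- For ν ≤ 1 the exponent 1 - ν is non-negative and |v_i|^{1-ν} is continuous everywhere; for ν > 1
it blows up at v_i = 0. -/
theorem continuousAt_circJacobian (hν : 0 < ν) {v : ι → ℝ} (hv : 1 < ν → ∀ i, v i ≠ 0) :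
    ContinuousAt (circJacobian ν mp) v := by
  have hj : ∀ i, ContinuousAt (fun v : ι → ℝ => |v i| ^ (1 - ν)) v := fun i => by
    refine ((continuous_apply i).abs.continuousAt).rpow_const ?_
    rcases le_or_gt ν 1 with h | h
    · exact .inr (by linarith)
    · exact .inl (abs_ne_zero.2 (hv h i))
  unfold circJacobian
  refine tendsto_finsetProd _ fun i _ => ?_
  exact continuousAt_const.mul
    ((continuousAt_const.mul (hj i)).rpow_const (.inr (by positivity)))

theorem map_circInv_volume (hν : 0 < ν) (hmp : ∀ i, 0 < mp i) :
    (volume : Measure (ι → ℝ)).map (circInv ν mp) =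
      volume.withDensity fun v => ENNReal.ofReal (circJacobian ν mp v) := by
  have hmap := fun i => map_signedPow_volume hν (hmp i)
  have : ∀ i, SigmaFinite ((volume : Measure ℝ).map fun y => signedPow y ν / mp i) := fun i => by
    rw [hmap i]
    exact SigmaFinite.withDensity_of_ne_top (ae_of_all _ fun _ => ENNReal.ofReal_ne_top)
  have h := Measure.pi_map_pi (μ := fun _ : ι => (volume : Measure ℝ))
    (f := fun i y => signedPow y ν / mp i)
    fun i => ((continuous_signedPow hν).div_const _).measurable.aemeasurable
  simp_rw [hmap] at h
  rw [pi_withDensity _ (fun i => by fun_prop) (fun _ _ => ENNReal.ofReal_ne_top)] at h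
  rw [volume_pi]
  refine h.trans ?_
  congr 1
  ext v
  rw [circJacobian, ENNReal.ofReal_prod_of_nonneg fun i _ => ?_]
  have := hmp i
  positivity

end CoordinatewisePow

/-! ### The intensity measure as a radial integral of the density. -/

section Intensity

variable {ι : Type*} [Fintype ι]

/-- The substitution `ζ = r^{-ν}` in the mixing integral of the intensity measure. -/
theorem lintegral_comp_rpow_neg {ν : ℝ} (hν : 0 < ν) (g : ℝ → ℝ≥0∞) :
    ∫⁻ ζ in Set.Ioi (0 : ℝ), g ζ * ENNReal.ofReal ((ζ ^ 2)⁻¹) =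
      ∫⁻ r in Set.Ioi (0 : ℝ), ENNReal.ofReal (ν * r ^ (ν - 1)) * g (r ^ (-ν)) := by
  have himage : (fun r : ℝ => r ^ (-ν)) '' Set.Ioi 0 = Set.Ioi 0 := by
    ext v
    constructor
    · rintro ⟨r, hr, rfl⟩
      exact Real.rpow_pos_of_pos hr _
    · intro hv
      refine ⟨v ^ (-ν)⁻¹, Real.rpow_pos_of_pos hv _, ?_⟩
      exact Real.rpow_inv_rpow (le_of_lt hv) (neg_ne_zero.2 hν.ne')
  have hinj : Set.InjOn (fun r : ℝ => r ^ (-ν)) (Set.Ioi 0) := fun r hr r' hr' h =>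
    (Real.rpow_left_inj (le_of_lt hr) (le_of_lt hr') (neg_ne_zero.2 hν.ne')).1 h
  have hderiv : ∀ r ∈ Set.Ioi (0 : ℝ),
      HasDerivWithinAt (fun r : ℝ => r ^ (-ν)) (-ν * r ^ (-ν - 1)) (Set.Ioi 0) r := fun r hr =>
    (Real.hasDerivAt_rpow_const (.inl (ne_of_gt hr))).hasDerivWithinAt
  conv_lhs => rw [← himage]
  rw [lintegral_image_eq_lintegral_abs_deriv_mul measurableSet_Ioi hderiv hinj]
  refine setLIntegral_congr_fun measurableSet_Ioi fun r hr => ?_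
  have hr : 0 < r := hr
  rw [mul_comm (g _), ← mul_assoc, ← ENNReal.ofReal_mul (abs_nonneg _)]
  congr 2
  rw [abs_mul, abs_neg, abs_of_pos hν, abs_of_pos (by positivity), mul_assoc,
    ← Real.rpow_natCast, ← Real.rpow_mul hr.le, ← Real.rpow_neg hr.le, ← Real.rpow_add hr]
  congr 2
  push_cast
  ring

theorem lintegral_eq_pow_card_mul_lintegral_smul {r : ℝ} (hr : 0 < r) {g : (ι → ℝ) → ℝ≥0∞} (hg : Measurable g) :
    ∫⁻ y, g y = ENNReal.ofReal (r ^ Fintype.card ι) * ∫⁻ y, g (r • y) := by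
  have h := lintegral_map (μ := (volume : Measure (ι → ℝ))) hg (measurable_const_smul r)
  rw [Measure.map_addHaar_smul _ hr.ne', lintegral_smul_measure, Module.finrank_fintype_fun_eq_card,
    abs_of_pos (by positivity), smul_eq_mul] at h
  rw [← h, ← mul_assoc, ← ENNReal.ofReal_mul (by positivity), mul_inv_cancel₀ (by positivity),
    ENNReal.ofReal_one, one_mul]

variable {Ω : Type*} [MeasurableSpace Ω] {X : Type*}

/-- The intensity measure of a process whose finite-dimensional law has density `F`. -/
theorem intensityMeasure_eq_lintegral {P : Measure Ω} {ν : ℝ} (hν : 0 < ν) {W : X → Ω → ℝ}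
    {x : ι → X} (hW : ∀ i, Measurable (W (x i))) (hmp : ∀ i, 0 < mPlus P ν W (x i))
    {F : (ι → ℝ) → ℝ≥0∞} (hF : Measurable F)
    (hlaw : P.map (fun ω i => W (x i) ω) = volume.withDensity F)
    {A : Set (ι → ℝ)} (hA : MeasurableSet A) :
    intensityMeasure P ν W x A =
      ∫⁻ v in A, ENNReal.ofReal (circJacobian ν (fun i => mPlus P ν W (x i)) v) *
        ∫⁻ r in Set.Ioi (0 : ℝ), ENNReal.ofReal (ν * r ^ (ν + Fintype.card ι - 1)) *
          F (r • circ ν (fun i => mPlus P ν W (x i)) v) := by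
  set mp : ι → ℝ := fun i => mPlus P ν W (x i) with hmpdef
  set T := circInv ν mp with hT
  have hTm : Measurable T := (continuous_circInv hν).measurable
  have hWm : Measurable fun ω i => W (x i) ω := measurable_pi_lambda _ hW
  have hinner : ∀ ζ : ℝ, P {ω | (fun i => ζ * signedPow (W (x i) ω) ν / mPlus P ν W (x i)) ∈ A} =
      ∫⁻ y, F y * A.indicator 1 (ζ • T y) := fun ζ => by
    have hpre : MeasurableSet ((fun y => ζ • T y) ⁻¹' A) := (hTm.const_smul ζ) hA
    have hset : {ω | (fun i => ζ * signedPow (W (x i) ω) ν / mPlus P ν W (x i)) ∈ A} =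
        (fun ω i => W (x i) ω) ⁻¹' ((fun y => ζ • T y) ⁻¹' A) := by
      ext ω
      simp only [Set.mem_ofPred_eq, Set.mem_preimage, hT, hmpdef]
      congr! 2 with i
      simp [circInv, mul_div_assoc]
    rw [hset, ← Measure.map_apply hWm hpre, hlaw, withDensity_apply _ hpre,
      ← lintegral_indicator hpre]
    refine lintegral_congr fun y => ?_
    by_cases hy : ζ • T y ∈ A
    · rw [Set.indicator_of_mem (by exact hy), Set.indicator_of_mem hy, Pi.one_apply, mul_one]
    · rw [Set.indicator_of_notMem (by exact hy), Set.indicator_of_notMem hy, mul_zero]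
  have hind : Measurable (A.indicator (1 : (ι → ℝ) → ℝ≥0∞)) := measurable_one.indicator hA
  -- Replacing y by r y contributes r^n, and r^{-ν} T(r y) = T(y) frees the indicator of r, so the
  -- two integrals can be exchanged and the indicator pulled out.
  have hscale : ∀ r ∈ Set.Ioi (0 : ℝ), ENNReal.ofReal (ν * r ^ (ν - 1)) *
      ∫⁻ y, F y * A.indicator 1 (r ^ (-ν) • T y) =
      ∫⁻ y, A.indicator 1 (T y) *
        (ENNReal.ofReal (ν * r ^ (ν + Fintype.card ι - 1)) * F (r • y)) := by
    intro r hr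
    have hr : 0 < r := hr
    rw [lintegral_eq_pow_card_mul_lintegral_smul hr
      (show Measurable fun y => F y * A.indicator 1 (r ^ (-ν) • T y) from
        hF.mul (hind.comp (hTm.const_smul (r ^ (-ν))))), ← mul_assoc,
      ← ENNReal.ofReal_mul (by positivity), ← lintegral_const_mul' _ _ ENNReal.ofReal_ne_top]
    refine lintegral_congr fun y => ?_
    have h1 : r ^ (-ν) • T (r • y) = T y := by
      rw [hT, circInv_smul hr, smul_smul, ← Real.rpow_add hr, neg_add_cancel, Real.rpow_zero,
        one_smul]
    have h2 : ν * r ^ (ν - 1) * r ^ Fintype.card ι = ν * r ^ (ν + Fintype.card ι - 1) := by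
      rw [mul_assoc, ← Real.rpow_natCast, ← Real.rpow_add hr]
      congr 2
      ring
    rw [h1, h2]
    ring
  have hjoint : Measurable fun z : (ι → ℝ) × ℝ =>
      ENNReal.ofReal (ν * z.2 ^ (ν + Fintype.card ι - 1)) * F (z.2 • z.1) :=
    Measurable.mul (by fun_prop) (hF.comp (measurable_snd.smul measurable_fst))
  have hG : Measurable fun y : ι → ℝ => ∫⁻ r in Set.Ioi (0 : ℝ),
      ENNReal.ofReal (ν * r ^ (ν + Fintype.card ι - 1)) * F (r • y) :=
    hjoint.lintegral_prod_right'
  have hGc : Measurable fun v => A.indicator 1 v * ∫⁻ r in Set.Ioi (0 : ℝ),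
      ENNReal.ofReal (ν * r ^ (ν + Fintype.card ι - 1)) * F (r • circ ν mp v) :=
    hind.mul (hG.comp (continuous_circ hν).measurable)
  calc intensityMeasure P ν W x A
      = ∫⁻ r in Set.Ioi (0 : ℝ), ∫⁻ y, A.indicator 1 (T y) *
        (ENNReal.ofReal (ν * r ^ (ν + Fintype.card ι - 1)) * F (r • y)) := by
        rw [intensityMeasure]
        simp_rw [hinner]
        rw [lintegral_comp_rpow_neg hν, setLIntegral_congr_fun measurableSet_Ioi hscale]
    _ = ∫⁻ y, A.indicator 1 (T y) * ∫⁻ r in Set.Ioi (0 : ℝ),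
        ENNReal.ofReal (ν * r ^ (ν + Fintype.card ι - 1)) * F (r • y) := by
        rw [lintegral_lintegral_swap (Measurable.aemeasurable ?_)]
        · refine lintegral_congr fun y => lintegral_const_mul' _ _ ?_
          by_cases hy : T y ∈ A <;> simp [hy]
        · exact ((hind.comp (hTm.comp measurable_snd))).mul (hjoint.comp measurable_swap)
    _ = ∫⁻ v, A.indicator 1 v * (∫⁻ r in Set.Ioi (0 : ℝ),
        ENNReal.ofReal (ν * r ^ (ν + Fintype.card ι - 1)) * F (r • circ ν mp v))
          ∂(volume.map T) := by
        rw [lintegral_map hGc hTm]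
        refine lintegral_congr fun y => ?_
        rw [hT, circ_circInv hν hmp]
    _ = _ := by
        rw [hT, map_circInv_volume hν hmp, lintegral_withDensity_eq_lintegral_mul _
          measurable_circJacobian.ennreal_ofReal hGc,
          ← lintegral_indicator hA]
        refine lintegral_congr fun v => ?_
        by_cases hv : v ∈ A
        · rw [Set.indicator_of_mem hv, Pi.mul_apply, Set.indicator_of_mem hv, Pi.one_apply, one_mul]
        · rw [Set.indicator_of_notMem hv, Pi.mul_apply, Set.indicator_of_notMem hv, zero_mul,
            mul_zero]

end Intensity

/-! ### Intensity functions for skewed Gaussian densities. -/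

section ModelIntensity

variable {ι : Type*} [Fintype ι] [DecidableEq ι]

/-- The normalizing constant of the centred Gaussian density. -/
noncomputable def gaussianConst (R : Matrix ι ι ℝ) : ℝ :=
  (2 * Real.pi) ^ (-(Fintype.card ι : ℝ) / 2) * R.det ^ (-(1 / 2) : ℝ)

theorem gaussianConst_pos {R : Matrix ι ι ℝ} (hR : R.PosDef) : 0 < gaussianConst R := by
  have := hR.det_pos
  unfold gaussianConst
  positivity

/-- The intensity function of a process whose finite-dimensional law has the density
`K φ(y; R) Φ(βᵀ y + τ)`. -/
noncomputable def skewIntensity (ν : ℝ) (mp : ι → ℝ) (R : Matrix ι ι ℝ) (K : ℝ) (β : ι → ℝ)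
    (τ : ℝ) (v : ι → ℝ) : ℝ :=
  circJacobian ν mp v * (ν * K * gaussianConst R *
    radialIntegral (ν + Fintype.card ι) (quadForm R⁻¹ (circ ν mp v)) (β ⬝ᵥ circ ν mp v) τ)

variable {ν : ℝ} {mp : ι → ℝ} {R : Matrix ι ι ℝ} {K : ℝ} (β : ι → ℝ) (τ : ℝ)

theorem skewIntensity_nonneg (hν : 0 < ν) (hmp : ∀ i, 0 < mp i) (hR : R.PosDef) (hK : 0 < K)
    (v : ι → ℝ) : 0 ≤ skewIntensity ν mp R K β τ v := by
  have h1 := circJacobian_nonneg hν hmp v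
  have h2 := gaussianConst_pos hR
  have h3 := radialIntegral_nonneg (ν + Fintype.card ι) (quadForm R⁻¹ (circ ν mp v))
    (β ⬝ᵥ circ ν mp v) τ
  unfold skewIntensity
  positivity

theorem skewIntensity_pos [Nonempty ι] (hν : 0 < ν) (hmp : ∀ i, 0 < mp i) (hR : R.PosDef)
    (hK : 0 < K) {v : ι → ℝ} (hv : ∀ i, v i ≠ 0) : 0 < skewIntensity ν mp R K β τ v := by
  have hv0 : v ≠ 0 := fun h => hv (Classical.arbitrary ι) (congrFun h _)
  have h1 := circJacobian_pos hν hmp hv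
  have h2 := gaussianConst_pos hR
  have h3 := radialIntegral_pos (p := ν + Fintype.card ι) (by positivity)
    (quadForm_pos hR.inv (circ_ne_zero (ν := ν) hmp hv0)) (β ⬝ᵥ circ ν mp v) τ
  unfold skewIntensity
  positivity

omit [DecidableEq ι] in
theorem continuous_quadForm (S : Matrix ι ι ℝ) : Continuous (quadForm S) := by
  unfold quadForm dotProduct mulVec dotProduct
  fun_prop

omit [DecidableEq ι] in
theorem continuous_dotProduct_left (β : ι → ℝ) : Continuous fun y : ι → ℝ => β ⬝ᵥ y := by
  unfold dotProduct
  fun_prop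

theorem measurable_skewIntensity (hν : 0 < ν) : Measurable (skewIntensity ν mp R K β τ) := by
  have hc := (continuous_circ (mp := mp) hν)
  exact measurable_circJacobian.mul (((measurable_radialIntegral _ τ).comp
    (((continuous_quadForm R⁻¹).comp hc).measurable.prodMk
      ((continuous_dotProduct_left β).comp hc).measurable)).const_mul _)

theorem continuousOn_skewIntensity (hν : 0 < ν) (hmp : ∀ i, 0 < mp i) (hR : R.PosDef) :
    ContinuousOn (skewIntensity ν mp R K β τ) (regularSet ι ν) := by
  intro v hv
  refine ContinuousAt.continuousWithinAt ?_
  have hc := (continuous_circ (mp := mp) hν)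
  have hpair : Continuous fun v => (quadForm R⁻¹ (circ ν mp v), β ⬝ᵥ circ ν mp v) :=
    ((continuous_quadForm R⁻¹).comp hc).prodMk ((continuous_dotProduct_left β).comp hc)
  have hrad := continuousAt_radialIntegral (p := ν + Fintype.card ι) (by positivity) τ
    (z := (quadForm R⁻¹ (circ ν mp v), β ⬝ᵥ circ ν mp v))
    (quadForm_pos hR.inv (circ_ne_zero hmp hv.1))
  exact (continuousAt_circJacobian hν hv.2).mul
    (continuousAt_const.mul (hrad.comp (f := fun v => (quadForm R⁻¹ (circ ν mp v),
      β ⬝ᵥ circ ν mp v)) hpair.continuousAt))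

omit [DecidableEq ι] in
theorem quadForm_smul_right (S : Matrix ι ι ℝ) (r : ℝ) (y : ι → ℝ) :
    quadForm S (r • y) = r ^ 2 * quadForm S y := by
  rw [quadForm, mulVec_smul, smul_dotProduct, dotProduct_smul, quadForm, smul_eq_mul, smul_eq_mul]
  ring

/-- Along the ray r w the Gaussian exponent scales by r² and the slant term by r. The condition w ≠
0 makes the quadratic form positive and the integral finite. -/
theorem lintegral_radial_density (hν : 0 < ν) (hR : R.PosDef) (hK : 0 < K) {w : ι → ℝ}
    (hw : w ≠ 0) :
    ∫⁻ r in Set.Ioi (0 : ℝ), ENNReal.ofReal (ν * r ^ (ν + Fintype.card ι - 1)) *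
        ENNReal.ofReal (K * (gaussianDensity R (r • w) * normalCdf (β ⬝ᵥ (r • w) + τ))) =
      ENNReal.ofReal (ν * K * gaussianConst R *
        radialIntegral (ν + Fintype.card ι) (quadForm R⁻¹ w) (β ⬝ᵥ w) τ) := by
  have hc := gaussianConst_pos hR
  rw [ENNReal.ofReal_mul (by positivity), ← lintegral_radialIntegrand (by positivity)
    (quadForm_pos hR.inv hw), ← lintegral_const_mul' _ _ ENNReal.ofReal_ne_top]
  refine setLIntegral_congr_fun measurableSet_Ioi fun r hr => ?_
  have hr : 0 < r := hr
  rw [← ENNReal.ofReal_mul (by positivity), ← ENNReal.ofReal_mul (by positivity)]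
  congr 1
  rw [gaussianDensity, quadForm_smul_right, dotProduct_smul, smul_eq_mul, radialIntegrand,
    gaussianConst]
  ring

theorem isIntensityFunction_skewIntensity [Nonempty ι] {Ω : Type*} [MeasurableSpace Ω] {X : Type*}
    {P : Measure Ω} (hν : 0 < ν) {W : X → Ω → ℝ} {x : ι → X} (hW : ∀ i, Measurable (W (x i)))
    (hmp : ∀ i, 0 < mPlus P ν W (x i)) (hR : R.PosDef) (hK : 0 < K)
    (hlaw : P.map (fun ω i => W (x i) ω) = volume.withDensity fun y =>
      ENNReal.ofReal (K * (gaussianDensity R y * normalCdf (β ⬝ᵥ y + τ)))) :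
    IsIntensityFunction P ν W x (skewIntensity ν (fun i => mPlus P ν W (x i)) R K β τ) := by
  refine ⟨measurable_skewIntensity β τ hν, skewIntensity_nonneg β τ hν hmp hR hK, fun A hA => ?_⟩
  have hF : Measurable fun y =>
      ENNReal.ofReal (K * (gaussianDensity R y * normalCdf (β ⬝ᵥ y + τ))) :=
    (((measurable_gaussianDensity R).mul (measurable_normalCdf.comp
      ((continuous_dotProduct_left β).measurable.add_const τ))).const_mul K).ennreal_ofReal
  rw [intensityMeasure_eq_lintegral hν hW hmp hF hlaw hA]
  refine lintegral_congr_ae (ae_restrict_of_ae ?_)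
  -- The origin must be avoided, since the ray integral diverges there; one non-zero coordinate
  -- suffices.
  have hne : ∀ᵐ v : ι → ℝ, v (Classical.arbitrary ι) ≠ 0 := Measure.ae_eval_ne _ _ _
  filter_upwards [hne] with v hv
  have hv0 : v ≠ 0 := fun h => hv (congrFun h _)
  rw [lintegral_radial_density β τ hν hR hK (circ_ne_zero hmp hv0),
    ← ENNReal.ofReal_mul (circJacobian_nonneg hν hmp v)]
  rfl

end ModelIntensity

/-! ### Standardization of scale matrices. -/

section CorrelationMatrix

variable {ι : Type*} {S : Matrix ι ι ℝ}

theorem stdDev_smul {k : ℝ} (hk : 0 ≤ k) (S : Matrix ι ι ℝ) (i : ι) :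
    stdDev (k • S) i = √k * stdDev S i := by
  rw [stdDev, stdDev, Matrix.smul_apply, smul_eq_mul, Real.sqrt_mul hk]

theorem stdDev_pos (hS : S.PosDef) (i : ι) : 0 < stdDev S i :=
  Real.sqrt_pos.2 hS.diag_pos

/-- Hence the factor Q / (ν + d) in the conditional scale does not affect the correlation matrix,
which is that of Ω̃. -/
theorem corrMatrix_smul {k : ℝ} (hk : 0 < k) (S : Matrix ι ι ℝ) :
    corrMatrix (k • S) = corrMatrix S := by
  ext i j
  simp only [corrMatrix, of_apply, stdDev_smul hk.le, Matrix.smul_apply, smul_eq_mul]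
  rw [show √k * stdDev S i * (√k * stdDev S j) = (√k * √k) * (stdDev S i * stdDev S j) by ring,
    Real.mul_self_sqrt hk.le, mul_div_mul_left _ _ hk.ne']

variable [Fintype ι] [DecidableEq ι]

theorem diagonal_mul_corrMatrix_mul (hS : S.PosDef) :
    diagonal (stdDev S) * corrMatrix S * diagonal (stdDev S) = S := by
  ext i j
  rw [mul_diagonal, diagonal_mul, corrMatrix, of_apply]
  have := stdDev_pos hS i
  have := stdDev_pos hS j
  field_simp

/-- The slant ω̃ α_t undoes the standardization, which gives √(1 + α_tᵀΩ̃α_t) in the skew-t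
normalization. -/
theorem quadForm_corrMatrix (hS : S.PosDef) (a : ι → ℝ) :
    quadForm (corrMatrix S) (fun i => stdDev S i * a i) = quadForm S a := by
  have h : (fun i => stdDev S i * a i) = diagonal (stdDev S) *ᵥ a := by
    ext i
    rw [mulVec_diagonal]
  conv_rhs => rw [← diagonal_mul_corrMatrix_mul hS]
  rw [h, quadForm, quadForm, ← mulVec_mulVec, ← mulVec_mulVec, dotProduct_mulVec a,
    ← mulVec_transpose, diagonal_transpose]

theorem quadForm_corrMatrix_inv (hS : S.PosDef) (y : ι → ℝ) :
    quadForm (corrMatrix S)⁻¹ (fun i => y i / stdDev S i) = quadForm S⁻¹ y := by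
  have hD : IsUnit (diagonal (stdDev S)).det := by
    rw [det_diagonal]
    exact (Finset.prod_pos fun i _ => stdDev_pos hS i).ne'.isUnit
  have h : (diagonal (stdDev S))⁻¹ *ᵥ y = fun i => y i / stdDev S i := by
    have : y = diagonal (stdDev S) *ᵥ fun i => y i / stdDev S i := by
      ext i
      rw [mulVec_diagonal, mul_div_cancel₀ _ (stdDev_pos hS i).ne']
    conv_lhs => rw [this]
    rw [mulVec_mulVec, nonsing_inv_mul _ hD, one_mulVec]
  conv_rhs => rw [← diagonal_mul_corrMatrix_mul hS]
  rw [← h, quadForm, quadForm, Matrix.mul_inv_rev, Matrix.mul_inv_rev, ← mulVec_mulVec,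
    ← mulVec_mulVec, dotProduct_mulVec y, ← mulVec_transpose, transpose_nonsing_inv,
    diagonal_transpose]

omit [DecidableEq ι] in
theorem quadForm_smul_left (k : ℝ) (S : Matrix ι ι ℝ) (y : ι → ℝ) :
    quadForm (k • S) y = k * quadForm S y := by
  rw [quadForm, smul_mulVec, dotProduct_smul, smul_eq_mul, quadForm]

theorem quadForm_inv_smul {k : ℝ} (hk : k ≠ 0) (hS : S.PosDef) (y : ι → ℝ) :
    quadForm (k • S)⁻¹ y = k⁻¹ * quadForm S⁻¹ y := by
  have : (k • S)⁻¹ = k⁻¹ • S⁻¹ := by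
    have := invertibleOfNonzero hk
    rw [inv_smul S k ((isUnit_iff_isUnit_det _).1 hS.isUnit), invOf_eq_inv]
  rw [this, quadForm_smul_left]

end CorrelationMatrix

/-! ### The conditional skew-t density as a ratio of radial integrals. -/

section ConditionalDensity

variable {m d : ℕ} {R : Matrix (Fin m ⊕ Fin d) (Fin m ⊕ Fin d) ℝ}

theorem gaussianConst_eq_mul (hR : R.PosDef) :
    gaussianConst R = gaussianConst R.toBlocks₂₂ * gaussianConst (schur R) := by
  -- At the origin all exponentials equal 1, so the density factorization reduces to the constants.
  have h := gaussianDensity_sumElim hR 0 0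
  have h0 : condLocation R 0 = 0 := by rw [condLocation, mulVec_zero]
  have h1 : (Sum.elim 0 0 : Fin m ⊕ Fin d → ℝ) = 0 := by
    ext i
    cases i <;> rfl
  simpa [h0, h1, gaussianDensity, quadForm, gaussianConst] using h

theorem tDensity_condScale (hR : R.PosDef) {ν : ℝ} (hν : 0 < ν) {w : Fin d → ℝ} (hw : w ≠ 0)
    (x : Fin m → ℝ) :
    tDensity x (condLocation R w) (condScale R ν w) (ν + d) =
      2 ^ ((m : ℝ) / 2) * gaussianConst (schur R) *
        Real.Gamma ((ν + d + m) / 2) / Real.Gamma ((ν + d) / 2) *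
        quadForm R⁻¹ (Sum.elim x w) ^ (-((ν + d + m) / 2)) *
        quadForm (R.toBlocks₂₂)⁻¹ w ^ ((ν + d) / 2) := by
  have hS := posDef_schur hR
  have hdet := hS.det_pos
  have hQ := quadForm_pos (posDef_toBlocks₂₂ hR).inv hw
  have hq0 := quadForm_nonneg hS.inv (x - condLocation R w)
  have hsplit := quadForm_inv_sumElim hR x w
  set Q := quadForm (R.toBlocks₂₂)⁻¹ w
  set q := quadForm R⁻¹ (Sum.elim x w)
  have hq : 0 < q := by linarith
  obtain ⟨p, hp⟩ : ∃ p, p = ν + d := ⟨_, rfl⟩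
  have hp0 : 0 < p := by rw [hp]; positivity
  have hG : 0 < Real.Gamma (p / 2) := Real.Gamma_pos_of_pos (half_pos hp0)
  have hk : 0 < Q / p := by positivity
  have hpi := Real.pi_pos
  -- This is what the scale Q / (ν + d) is for: the degrees of freedom cancel and the Student-t base
  -- becomes q / Q.
  have hbase : 1 + quadForm (condScale R ν w)⁻¹ (x - condLocation R w) / p = q / Q := by
    rw [condScale, ← hp, quadForm_inv_smul hk.ne' hS, hsplit]
    field_simp
    ring
  have hdetS : √(condScale R ν w).det = (Q / p) ^ ((m : ℝ) / 2) * √(schur R).det := by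
    rw [condScale, ← hp, det_smul, Fintype.card_fin, Real.sqrt_mul (by positivity),
      Real.sqrt_eq_rpow, ← Real.rpow_natCast, ← Real.rpow_mul hk.le]
    congr 2
    ring
  rw [tDensity, ← hp, hbase, hdetS, Fintype.card_fin, gaussianConst, Fintype.card_fin,
    Real.div_rpow hq.le hQ.le, Real.div_rpow hQ.le hp0.le, Real.mul_rpow hp0.le hpi.le,
    Real.mul_rpow zero_le_two hpi.le, Real.sqrt_eq_rpow, Real.rpow_neg hdet.le,
    show -(p + m) / 2 = -((p + m) / 2) by ring, show -(m : ℝ) / 2 = -((m : ℝ) / 2) by ring,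
    Real.rpow_neg hq.le, Real.rpow_neg hQ.le, Real.rpow_neg zero_le_two, Real.rpow_neg hpi.le,
    show (p + m) / 2 = p / 2 + (m : ℝ) / 2 by ring, Real.rpow_add hQ]
  field_simp

/-- Evaluating both radial integrals by `radialIntegral_eq`, the prefactors combine to the Student-t
density and the two non-central t cdfs match argument by argument. -/
theorem skewTDensity_condParameters (hR : R.PosDef) {ν : ℝ} (hν : 0 < ν) (α : Fin m ⊕ Fin d → ℝ)
    (τ : ℝ) {w : Fin d → ℝ} (hw : w ≠ 0) (x : Fin m → ℝ) :
    skewTDensity x (condLocation R w) (condScale R ν w) (condSlant R α) (condExtension R α ν w)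
        (-τ) (ν + d) =
      gaussianConst R * radialIntegral (ν + Fintype.card (Fin m ⊕ Fin d))
          (quadForm R⁻¹ (Sum.elim x w)) (α ⬝ᵥ Sum.elim x w) τ /
        (gaussianConst R.toBlocks₂₂ * radialIntegral (ν + Fintype.card (Fin d))
          (quadForm (R.toBlocks₂₂)⁻¹ w) (((margScale R α)⁻¹ • margDirection R α) ⬝ᵥ w)
          (τ / margScale R α)) := by
  have hS := posDef_schur hR
  have hQ := quadForm_pos (posDef_toBlocks₂₂ hR).inv hw
  have hq0 := quadForm_nonneg hS.inv (x - condLocation R w)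
  have hsplit := quadForm_inv_sumElim hR x w
  have ht := tDensity_condScale hR hν hw x
  have hC := margScale_pos hR α
  have hcard : ν + (Fintype.card (Fin m ⊕ Fin d) : ℝ) = ν + d + m := by
    rw [Fintype.card_sum, Fintype.card_fin, Fintype.card_fin]
    push_cast
    ring
  have hgc := gaussianConst_pos (posDef_toBlocks₂₂ hR)
  rw [hcard, Fintype.card_fin]
  have hp0 : 0 < ν + d := by positivity
  have hk : 0 < quadForm (R.toBlocks₂₂)⁻¹ w / (ν + d) := by positivity
  have hsk : √(quadForm (R.toBlocks₂₂)⁻¹ w / (ν + d)) =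
    √(quadForm (R.toBlocks₂₂)⁻¹ w) / √(ν + d) := Real.sqrt_div hQ.le _
  have hcorr : corrMatrix (condScale R ν w) = corrMatrix (schur R) := corrMatrix_smul hk _
  have hc : √(1 + quadForm (corrMatrix (condScale R ν w)) (condSlant R α)) = margScale R α := by
    rw [hcorr, margScale, ← quadForm_corrMatrix hS]
    rfl
  have hz : quadForm (corrMatrix (condScale R ν w))⁻¹
      (fun i => (x i - condLocation R w i) / stdDev (condScale R ν w) i) =
      (quadForm (R.toBlocks₂₂)⁻¹ w / (ν + d))⁻¹ *
        quadForm (schur R)⁻¹ (x - condLocation R w) := by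
    have hcs : (condScale R ν w).PosDef := hS.smul hk
    rw [← quadForm_inv_smul hk.ne' hS]
    exact quadForm_corrMatrix_inv hcs (x - condLocation R w)
  have hdot : condSlant R α ⬝ᵥ
      (fun i => (x i - condLocation R w i) / stdDev (condScale R ν w) i) =
      (α ∘ Sum.inl) ⬝ᵥ (x - condLocation R w) * √(ν + d) / √(quadForm (R.toBlocks₂₂)⁻¹ w) := by
    rw [mul_div_assoc, ← inv_div (√(quadForm (R.toBlocks₂₂)⁻¹ w)), ← hsk, dotProduct, dotProduct,
      Finset.sum_mul]
    refine Finset.sum_congr rfl fun i _ => ?_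
    have := stdDev_pos hS i
    rw [condSlant, condScale, stdDev_smul hk.le, Pi.sub_apply, Function.comp_apply]
    field_simp
  rw [skewTDensity]
  simp only [hc, hz, hdot, ht, Fintype.card_fin]
  have hq : 0 < quadForm R⁻¹ (Sum.elim x w) := by linarith
  have hrad := radialIntegral_pos hp0 hQ (((margScale R α)⁻¹ • margDirection R α) ⬝ᵥ w)
    (τ / margScale R α)
  rw [radialIntegral_eq (by positivity) hq]
  rw [radialIntegral_eq hp0 hQ] at hrad ⊢
  rw [gaussianConst_eq_mul hR]
  have hG : 0 < Real.Gamma ((ν + d) / 2) := Real.Gamma_pos_of_pos (half_pos hp0)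
  have harg₂ : condExtension R α ν w / margScale R α =
      ((margScale R α)⁻¹ • margDirection R α) ⬝ᵥ w *
        √((ν + d) / quadForm (R.toBlocks₂₂)⁻¹ w) := by
    rw [smul_dotProduct, smul_eq_mul, Real.sqrt_div hp0.le, condExtension, ← margDirection]
    ring
  -- The denominator equals (ν + d) q / Q. The resulting factor √(Q / (ν + d)) cancels √(ν + d) / √Q
  -- in the slant and extension, leaving α·(x, w).
  have hrate : (ν + d + m) / (ν + d + (quadForm (R.toBlocks₂₂)⁻¹ w / (ν + d))⁻¹ *
      quadForm (schur R)⁻¹ (x - condLocation R w)) =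
      (ν + d + m) / quadForm R⁻¹ (Sum.elim x w) * (quadForm (R.toBlocks₂₂)⁻¹ w / (ν + d)) := by
    have hden : ν + d + (quadForm (R.toBlocks₂₂)⁻¹ w / (ν + d))⁻¹ *
        quadForm (schur R)⁻¹ (x - condLocation R w) =
        quadForm R⁻¹ (Sum.elim x w) / (quadForm (R.toBlocks₂₂)⁻¹ w / (ν + d)) := by
      rw [hsplit]
      field_simp
      ring
    rw [hden, div_div_eq_mul_div, mul_div_right_comm]
  have harg₁ : ((α ∘ Sum.inl) ⬝ᵥ (x - condLocation R w) * √(ν + d) /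
      √(quadForm (R.toBlocks₂₂)⁻¹ w) + condExtension R α ν w) *
      √((ν + d + m) / (ν + d + (quadForm (R.toBlocks₂₂)⁻¹ w / (ν + d))⁻¹ *
        quadForm (schur R)⁻¹ (x - condLocation R w))) =
      α ⬝ᵥ Sum.elim x w * √((ν + d + m) / quadForm R⁻¹ (Sum.elim x w)) := by
    have h1 : √(ν + d) ≠ 0 := (Real.sqrt_pos.2 hp0).ne'
    have h2 : √(quadForm (R.toBlocks₂₂)⁻¹ w) ≠ 0 := (Real.sqrt_pos.2 hQ).ne'
    rw [hrate, Real.sqrt_mul (by positivity), hsk, condExtension, ← margDirection,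
      dotProduct_sumElim hR]
    field_simp
  rw [harg₁, harg₂, neg_div]
  -- Positivity of the normalizing cdf is inherited from that of the radial integral.
  have hΨ := (pos_iff_pos_of_mul_pos hrad).1 (by positivity)
  rw [show (ν + d + m) / 2 = (m : ℝ) / 2 + (ν + d) / 2 by ring,
    show (m : ℝ) / 2 + (ν + d) / 2 - 1 = (m : ℝ) / 2 + ((ν + d) / 2 - 1) by ring,
    Real.rpow_add two_pos, Real.rpow_neg hQ.le]
  field_simp

end ConditionalDensity

/-! ### Marginal laws and the splitting of coordinates. -/

section MarginalLaw

variable {m d : ℕ}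

theorem lintegral_sumElim {F : (Fin m ⊕ Fin d → ℝ) → ℝ≥0∞} (hF : Measurable F) :
    ∫⁻ z, F z = ∫⁻ y : Fin d → ℝ, ∫⁻ x : Fin m → ℝ, F (Sum.elim x y) := by
  have h := (volume_measurePreserving_sumPiEquivProdPi_symm
    fun _ : Fin m ⊕ Fin d => ℝ).lintegral_comp hF
  rw [← h, Measure.volume_eq_prod, lintegral_prod_symm']
  · rfl
  · exact hF.comp (MeasurableEquiv.measurable _)

theorem measurable_comp_inr : Measurable fun z : Fin m ⊕ Fin d → ℝ => z ∘ Sum.inr :=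
  measurable_pi_lambda _ fun j => measurable_pi_apply (Sum.inr j)

/-- The marginal law of the second block of coordinates. -/
theorem map_comp_inr_withDensity {F : (Fin m ⊕ Fin d → ℝ) → ℝ≥0∞} (hF : Measurable F) :
    (volume.withDensity F).map (fun z => z ∘ Sum.inr) =
      volume.withDensity fun y => ∫⁻ x : Fin m → ℝ, F (Sum.elim x y) := by
  have hm := measurable_comp_inr (m := m) (d := d)
  ext A hA
  rw [Measure.map_apply hm hA, withDensity_apply _ (hm hA), withDensity_apply _ hA,
    ← lintegral_indicator (hm hA), lintegral_sumElim (hF.indicator (hm hA)),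
    ← lintegral_indicator hA]
  refine lintegral_congr fun y => ?_
  by_cases hy : y ∈ A
  · rw [Set.indicator_of_mem hy]
    exact lintegral_congr fun x => Set.indicator_of_mem (by exact hy) _
  · rw [Set.indicator_of_notMem hy]
    refine (lintegral_congr fun x => Set.indicator_of_notMem ?_ _).trans lintegral_zero
    exact hy

/-- Carries almost-everywhere statements about joint vectors over to pairs (v, u). -/
theorem quasiMeasurePreserving_sumElim :
    Measure.QuasiMeasurePreserving
      fun p : (Fin d → ℝ) × (Fin m → ℝ) => (Sum.elim p.2 p.1 : Fin m ⊕ Fin d → ℝ) :=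
  ((volume_measurePreserving_sumPiEquivProdPi_symm fun _ : Fin m ⊕ Fin d => ℝ).comp
    (Measure.measurePreserving_swap (μ := (volume : Measure (Fin d → ℝ)))
      (ν := (volume : Measure (Fin m → ℝ))))).quasiMeasurePreserving

end MarginalLaw

/-- Both are densities of one measure with respect to the σ-finite Lebesgue measure; non-negativity
removes `ENNReal.ofReal`. -/
theorem IsIntensityFunction.ae_eq {ι : Type*} [Fintype ι] {Ω : Type*} [MeasurableSpace Ω]
    {X : Type*} {P : Measure Ω} {ν : ℝ} {W : X → Ω → ℝ} {x : ι → X} {lam lam' : (ι → ℝ) → ℝ}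
    (h : IsIntensityFunction P ν W x lam) (h' : IsIntensityFunction P ν W x lam') :
    lam =ᵐ[volume] lam' := by
  have hd : volume.withDensity (fun v => ENNReal.ofReal (lam v)) =
      volume.withDensity fun v => ENNReal.ofReal (lam' v) := by
    ext A hA
    rw [withDensity_apply _ hA, withDensity_apply _ hA, ← h.2.2 A hA, h'.2.2 A hA]
  rw [withDensity_eq_iff_of_sigmaFinite h.1.ennreal_ofReal.aemeasurable
    h'.1.ennreal_ofReal.aemeasurable] at hd
  filter_upwards [hd] with v hv
  exact (ENNReal.ofReal_eq_ofReal_iff (h.2.1 v) (h'.2.1 v)).1 hv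

/-! ### The extended skew-normal model and the ratio of intensities. -/

section Model

variable {m d : ℕ} {R : Matrix (Fin m ⊕ Fin d) (Fin m ⊕ Fin d) ℝ}

theorem extSkewNormal_eq_withDensity {ι : Type*} [Fintype ι] [DecidableEq ι] (R : Matrix ι ι ℝ)
    (α : ι → ℝ) (τ : ℝ) :
    extSkewNormal R α τ = volume.withDensity fun y =>
      ENNReal.ofReal ((normalCdf (τ / √(1 + quadForm R α)))⁻¹ *
        (gaussianDensity R y * normalCdf (α ⬝ᵥ y + τ))) := by
  simp_rw [extSkewNormal, extSkewNormalDensity, div_eq_inv_mul]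

/-- The normalizing constant is left in its joint form, so that it cancels in the ratio of
intensities. -/
theorem map_comp_inr_extSkewNormal (hR : R.PosDef) (α : Fin m ⊕ Fin d → ℝ) (τ : ℝ) :
    (extSkewNormal R α τ).map (fun z => z ∘ Sum.inr) = volume.withDensity fun y =>
      ENNReal.ofReal ((normalCdf (τ / √(1 + quadForm R α)))⁻¹ *
        (gaussianDensity R.toBlocks₂₂ y *
          normalCdf (((margScale R α)⁻¹ • margDirection R α) ⬝ᵥ y + τ / margScale R α))) := by
  have hK := inv_pos.2 (normalCdf_pos (τ / √(1 + quadForm R α)))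
  have hF : Measurable fun y => ENNReal.ofReal ((normalCdf (τ / √(1 + quadForm R α)))⁻¹ *
      (gaussianDensity R y * normalCdf (α ⬝ᵥ y + τ))) :=
    (((measurable_gaussianDensity R).mul (measurable_normalCdf.comp
      ((continuous_dotProduct_left α).measurable.add_const τ))).const_mul _).ennreal_ofReal
  rw [extSkewNormal_eq_withDensity, map_comp_inr_withDensity hF]
  simp_rw [ENNReal.ofReal_mul hK.le]
  congr 1
  ext y
  rw [lintegral_const_mul' _ _ ENNReal.ofReal_ne_top, lintegral_extSkew_sumElim hR]

theorem circ_sumElim (ν : ℝ) (mt u : Fin m → ℝ) (ms v : Fin d → ℝ) :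
    circ ν (Sum.elim mt ms) (Sum.elim u v) = Sum.elim (circ ν mt u) (circ ν ms v) := by
  ext i
  cases i <;> rfl

theorem circJacobian_sumElim (ν : ℝ) (mt u : Fin m → ℝ) (ms v : Fin d → ℝ) :
    circJacobian ν (Sum.elim mt ms) (Sum.elim u v) =
      circJacobian ν mt u * circJacobian ν ms v := by
  simp [circJacobian, Fintype.prod_sum_type]

/-- The ratio of the joint and the marginal intensity. -/
theorem skewIntensity_div_skewIntensity (hd : 1 ≤ d) (hR : R.PosDef) {ν : ℝ} (hν : 0 < ν)
    {K : ℝ} (hK : 0 < K) (α : Fin m ⊕ Fin d → ℝ) (τ : ℝ) (mt : Fin m → ℝ) {ms : Fin d → ℝ}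
    (hms : ∀ j, 0 < ms j) (u : Fin m → ℝ) {v : Fin d → ℝ} (hv : ∀ j, 0 < v j) :
    skewIntensity ν (Sum.elim mt ms) R K α τ (Sum.elim u v) /
        skewIntensity ν ms R.toBlocks₂₂ K ((margScale R α)⁻¹ • margDirection R α)
          (τ / margScale R α) v =
      skewTCondIntensity R α τ ν mt ms v u := by
  have hJ := circJacobian_pos hν hms fun j => (hv j).ne'
  have hw : circ ν ms v ≠ 0 :=
    circ_ne_zero hms fun h => (hv ⟨0, hd⟩).ne' (congrFun h _)
  have hu : (ν ^ m)⁻¹ * ∏ i, (mt i * |u i| ^ (1 - ν)) ^ (1 / ν) = circJacobian ν mt u := by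
    rw [circJacobian, Finset.prod_mul_distrib, Finset.prod_const, Finset.card_univ,
      Fintype.card_fin, inv_pow]
  have hgc := gaussianConst_pos (posDef_toBlocks₂₂ hR)
  have hrad := radialIntegral_pos (p := ν + Fintype.card (Fin d)) (by positivity)
    (quadForm_pos (posDef_toBlocks₂₂ hR).inv hw)
    (((margScale R α)⁻¹ • margDirection R α) ⬝ᵥ circ ν ms v) (τ / margScale R α)
  rw [skewTCondIntensity, skewTDensity_condParameters hR hν α τ hw, hu, skewIntensity,
    skewIntensity, circ_sumElim, circJacobian_sumElim]
  field_simp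

end Model

end ExtremalSkewT

/-! ### The conditional intensity formula. -/

theorem proposition2 {k m d : ℕ} (hd : 1 ≤ d)
    {S : Set (EuclideanSpace ℝ (Fin k))}
    {Ω : Type*} [MeasurableSpace Ω] (P : Measure Ω) [IsProbabilityMeasure P]
    (ν : ℝ) (hν : 0 < ν) (W : S → Ω → ℝ)
    (hW : ExtremalSkewT.IsSpectralProcess S P ν W)
    (t : Fin m → S) (s : Fin d → S)
    (R : Matrix (Fin m ⊕ Fin d) (Fin m ⊕ Fin d) ℝ)
    (α : Fin m ⊕ Fin d → ℝ) (τ : ℝ)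
    (hRdiag : ∀ i, R i i = 1) (hR : R.PosDef)
    (hlaw : P.map (fun ω i => W (Sum.elim t s i) ω) = ExtremalSkewT.extSkewNormal R α τ) :
    (∃ (lamTS : (Fin m ⊕ Fin d → ℝ) → ℝ) (lamS : (Fin d → ℝ) → ℝ),
      ExtremalSkewT.IsIntensityFunction P ν W (Sum.elim t s) lamTS ∧
      ExtremalSkewT.IsIntensityFunction P ν W s lamS ∧
      ContinuousOn lamTS (ExtremalSkewT.regularSet (Fin m ⊕ Fin d) ν) ∧
      ContinuousOn lamS (ExtremalSkewT.regularSet (Fin d) ν) ∧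
      ∀ (v : Fin d → ℝ) (u : Fin m → ℝ), (∀ j, 0 < v j) → (1 < ν → ∀ i, u i ≠ 0) →
        0 < lamS v ∧
        ExtremalSkewT.condIntensity lamTS lamS v u =
          ExtremalSkewT.skewTCondIntensity R α τ ν
            (fun i => ExtremalSkewT.mPlus P ν W (t i))
            (fun j => ExtremalSkewT.mPlus P ν W (s j)) v u) ∧
    (∀ (lamTS : (Fin m ⊕ Fin d → ℝ) → ℝ) (lamS : (Fin d → ℝ) → ℝ),
      ExtremalSkewT.IsIntensityFunction P ν W (Sum.elim t s) lamTS →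
      ExtremalSkewT.IsIntensityFunction P ν W s lamS →
      ∀ᵐ p : (Fin d → ℝ) × (Fin m → ℝ), (∀ j, 0 < p.1 j) →
        0 < lamS p.1 ∧
        ExtremalSkewT.condIntensity lamTS lamS p.1 p.2 =
          ExtremalSkewT.skewTCondIntensity R α τ ν
            (fun i => ExtremalSkewT.mPlus P ν W (t i))
            (fun j => ExtremalSkewT.mPlus P ν W (s j)) p.1 p.2) := by
  -- Supplies the non-emptiness of both index types required by the intensity lemmas.
  have : NeZero d := ⟨by omega⟩
  set K := (ExtremalSkewT.normalCdf (τ / √(1 + ExtremalSkewT.quadForm R α)))⁻¹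
  set β := (ExtremalSkewT.margScale R α)⁻¹ • ExtremalSkewT.margDirection R α
  set σ := τ / ExtremalSkewT.margScale R α
  have hK : 0 < K := inv_pos.2 (ExtremalSkewT.normalCdf_pos _)
  have hR' := ExtremalSkewT.posDef_toBlocks₂₂ hR
  have hlawS : P.map (fun ω j => W (s j) ω) = volume.withDensity fun y =>
      ENNReal.ofReal (K * (ExtremalSkewT.gaussianDensity R.toBlocks₂₂ y *
        ExtremalSkewT.normalCdf (β ⬝ᵥ y + σ))) := by
    rw [← ExtremalSkewT.map_comp_inr_extSkewNormal hR, ← hlaw, Measure.map_map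
      ExtremalSkewT.measurable_comp_inr (measurable_pi_lambda _ fun i => hW.measurable _)]
    rfl
  have hTS := ExtremalSkewT.isIntensityFunction_skewIntensity α τ hν
    (x := Sum.elim t s) (fun i => hW.measurable _) (fun i => hW.mPlus_pos _) hR hK
    (hlaw.trans (ExtremalSkewT.extSkewNormal_eq_withDensity R α τ))
  have hS := ExtremalSkewT.isIntensityFunction_skewIntensity β σ hν
    (fun j => hW.measurable (s j)) (fun j => hW.mPlus_pos _) hR' hK hlawS
  have hmp : (fun i => ExtremalSkewT.mPlus P ν W (Sum.elim t s i)) =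
      Sum.elim (fun i => ExtremalSkewT.mPlus P ν W (t i))
        fun j => ExtremalSkewT.mPlus P ν W (s j) := by
    ext i
    cases i <;> rfl
  have hformula := fun (v : Fin d → ℝ) (u : Fin m → ℝ) (hv : ∀ j, 0 < v j) =>
    ExtremalSkewT.skewIntensity_div_skewIntensity hd hR hν hK α τ
      (fun i => ExtremalSkewT.mPlus P ν W (t i)) (fun j => hW.mPlus_pos (s j)) u hv
  have hpos := fun (v : Fin d → ℝ) (hv : ∀ j, 0 < v j) =>
    ExtremalSkewT.skewIntensity_pos β σ hν (fun j => hW.mPlus_pos (s j)) hR' hK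
      fun j => (hv j).ne'
  refine ⟨⟨_, _, hTS, hS, ExtremalSkewT.continuousOn_skewIntensity α τ hν
    (fun i => hW.mPlus_pos _) hR, ExtremalSkewT.continuousOn_skewIntensity β σ hν
    (fun j => hW.mPlus_pos _) hR', fun v u hv _ => ⟨hpos v hv, ?_⟩⟩, ?_⟩
  · rw [hmp]
    exact hformula v u hv
  · intro lamTS lamS hlamTS hlamS
    have h1 := ExtremalSkewT.quasiMeasurePreserving_sumElim.ae (hlamTS.ae_eq hTS)
    have h2 := (Measure.quasiMeasurePreserving_fst (μ := (volume : Measure (Fin d → ℝ)))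
      (ν := (volume : Measure (Fin m → ℝ)))).ae (hlamS.ae_eq hS)
    filter_upwards [h1, h2] with p hp1 hp2 hv
    rw [ExtremalSkewT.condIntensity, hp1, hp2, hmp]
    exact ⟨hpos p.1 hv, hformula p.1 p.2 hv⟩
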